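/- \textbf{Setting.} Let $\Omega$ be a set of $n\ge 1$ arms with known costs $c(v)$ and let $B$ be a budget with $0<c(v)\le B$ for all $v\in\Omega$. Put $c(A)=\sum_{v\in A}c(v)$, $\mathbb S=\{A\subseteq\Omega: c(A)\le B\}$, $q=B/\min_v c(v)$ and $\tilde K=\min\{n,q\}$. Let $f:2^\Omega\to\mathbb R$ be monotone and submodular, and let $S^\star\in\arg\max_{S\in\mathbb S}f(S)$. There are $m'$ agents. If agent $i$ plays $A\in\mathbb S$ at time $t$ it receives $f_{i,t}(A)\in[0,1]$; the random functions $f_{i,t}$ are independent over $(i,t)$, and for each fixed $A\in\mathbb S$ the rewards $f_{i,t}(A)$ are identically distributed with mean $f(A)$. \textbf{Greedy+Max} (with access to values $\bar f$). Query $\emptyset$; start with $G=S=\emptyset$, $U=\Omega$. While $U\neq\emptyset$: query $G\cup\{e\}$ for all $e\in U$; let $s$ maximize $\bar f(G\cup\{e\})$ over $e\in U$, and let $a$ maximize $(\bar f(G\cup\{e\})-\bar f(G))/c(e)$ over $e\in U$; if $\bar f(G\cup\{s\})>\bar f(S)$, set $S=G\cup\{s\}$; then replace $G$ by $G\cup\{a\}$,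 and remove from $U$ the arm $a$ and all arms $e$ with $c(G)+c(e)>B$. Output $S$. Values already observed are stored, and ties are broken by any fixed rule that depends on the set of maximizers. \textbf{C-MA-MAB with Greedy+Max} (horizon $T$, number $1\le m\le m'$ of communicating agents). Let $\psi=n\tilde K$, $\delta=\tfrac12+\tilde K+2q$ and $r=\big\lceil m^{-1}\big(\delta\sqrt{\log T}\,\tfrac{Tm}{\psi}\big)^{2/3}\big\rceil$. A server runs Greedy+Max. Whenever a set $A$ is queried (a communication round), all $m'$ agents play $A$ for $r$ time steps, and the average of the local mean rewards of $m$ randomly selected agents is returned as $\bar f(A)$; the selection may have any law, but is independent of the rewards. After Greedy+Max has stopped with output $\Theta$, all agents play $\Theta$. Everything is truncated at time $T$. Let $S_{i,t}$ be the action of agent $i$ at time $t$, and let $$\mathcal R_i(T)=\sum_{t=1}^T\big(\tfrac12 f_{i,t}(S^\star)-f_{i,t}(S_{i,t})\big)$$ be its $\tfrac12$-regret. \textbf{Statement.} There are absolute constants $C$ and $\kappa\in\mathbb N$ such that in every such setting with $T\ge 2$ and $T\ge n\tilde K m$: (a) for every realization of the rewards and selections, the number of communication rounds is at most $C\,n\tilde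 K$ (in particular it is $\tilde{\mathcal O}(n\tilde K)$); (b) for every agent $i$, $$\mathbb E[\mathcal R_i(T)]\le C\,m^{-1/3}q^{2/3}\tilde K\,n^{1/3}T^{2/3}(\log T)^{\kappa},$$ that is, the expected $\tfrac12$-regret is $\tilde{\mathcal O}\big(m^{-1/3}q^{2/3}\tilde K n^{1/3}T^{2/3}\big)$. -/

import Mathlib

open MeasureTheory ProbabilityTheory

namespace CMAMAB

noncomputable section

/-! ### Set functions and the knapsack constraint -/

/-- Diminishing returns: `f(A ∪ {v}) - f(A) ≥ f(A' ∪ {v}) - f(A')` for `A ⊆ A'` and `v ∉ A'`. -/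
def IsSubmodular {V : Type*} [DecidableEq V] (f : Finset V → ℝ) : Prop :=
  ∀ A A' : Finset V, A ⊆ A' → ∀ v, v ∉ A' →
    f (insert v A') - f A' ≤ f (insert v A) - f A

/-- The cost of a set of arms is the sum of the costs of its elements. -/
def setCost {V : Type*} (c : V → ℝ) (A : Finset V) : ℝ := ∑ v ∈ A, c v

/-- The permitted actions under the knapsack constraint with budget `B`. -/
def knapsack {V : Type*} (c : V → ℝ) (B : ℝ) : Set (Finset V) := {A | setCost c A ≤ B}

/-- `q = B / c_min`, where `c_min` is the smallest cost of an arm. -/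
def budgetRatio {V : Type*} (c : V → ℝ) (B : ℝ) : ℝ := B / ⨅ v, c v

/-- `K̃ = min {n, q}`, the standard upper bound on the number of arms in a permitted action. -/
def sizeBound {V : Type*} [Fintype V] (c : V → ℝ) (B : ℝ) : ℝ :=
  min (Fintype.card V : ℝ) (budgetRatio c B)

/-! ### Offline algorithms with a value oracle -/

/-- A (deterministic, adaptive) offline algorithm with access to a value oracle: it either stops
with an output `Θ`, or queries the value of a set `A` and continues depending on the answer. -/
inductive OracleAlgorithm (V : Type*) : Type _
  | output (Θ : Finset V) : OracleAlgorithm V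
  | query (A : Finset V) (next : ℝ → OracleAlgorithm V) : OracleAlgorithm V

namespace OracleAlgorithm

/-- The set the algorithm is currently interested in: the queried set while it is running, its
output once it has stopped. -/
def action {V : Type*} : OracleAlgorithm V → Finset V
  | output Θ => Θ
  | query A _ => A

/-- The algorithm has not stopped: it is asking the oracle for a value. -/
def IsQuerying {V : Type*} : OracleAlgorithm V → Prop
  | output _ => False
  | query _ _ => True

/-- Continue with the oracle's answer `x`; nothing happens after the algorithm has stopped. -/
def feed {V : Type*} : OracleAlgorithm V → ℝ → OracleAlgorithm V
  | output Θ, _ => output Θ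
  | query _ next, x => next x

end OracleAlgorithm

/-! ### The algorithm Greedy+Max -/

/-- Query the value of `G ∪ {e}` for every `e` in the list, record the answers in a table, and
continue with the table. -/
def queryEach {V : Type*} [DecidableEq V] (G : Finset V) :
    List V → (V → ℝ) → ((V → ℝ) → OracleAlgorithm V) → OracleAlgorithm V
  | [], vals, k => k vals
  | e :: l, vals, k =>
      .query (insert e G) fun x => queryEach G l (Function.update vals e x) k

/-- The set of maximizers of `g` over `U`. -/
def maximizers {V : Type*} (U : Finset V) (g : V → ℝ) : Finset V :=
  open Classical in U.filter fun e => ∀ e' ∈ U, g e' ≤ g e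

/-- The main loop of Greedy+Max. `G` is the current greedy solution with observed value `vG`,
`S` is the best set found so far with observed value `vS`, and `U` is the set of arms which are not
in `G` and still fit into the budget. One pass evaluates `G ∪ {e}` for all `e ∈ U`, updates `S` by
the best augmentation of `G` by a single arm, adds to `G` the arm of the largest observed marginal
density `(f̄(G ∪ {e}) - f̄(G)) / c(e)`, and discards the arms that do not fit any more. It stops
when `U` is empty. Every pass removes an arm from `U`, so the first argument, which bounds the
number of passes, plays no role when it is at least the number of arms in `U`.
Ties are broken by `tie`. -/
def greedyMaxLoop {V : Type*} [DecidableEq V] (c : V → ℝ) (B : ℝ) (tie : Finset V → V) :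
    ℕ → (G : Finset V) → (vG : ℝ) → (S : Finset V) → (vS : ℝ) → (U : Finset V) →
      OracleAlgorithm V
  | 0, _, _, S, _, _ => .output S
  | p + 1, G, vG, S, vS, U =>
      if U = ∅ then .output S
      else
        queryEach G U.toList (fun _ => 0) fun vals =>
          let s := tie (maximizers U vals)
          let a := tie (maximizers U fun e => (vals e - vG) / c e)
          let G' := insert a G
          let U' := (U.erase a).filter fun e => setCost c G' + c e ≤ B
          if vS < vals s then
            greedyMaxLoop c B tie p G' (vals a) (insert s G) (vals s) U'
          else
            greedyMaxLoop c B tie p G' (vals a) S vS U'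

/-- Greedy+Max: start from `G = S = ∅` with all arms available. -/
def greedyMax {V : Type*} [Fintype V] [DecidableEq V] (c : V → ℝ) (B : ℝ) (tie : Finset V → V) :
    OracleAlgorithm V :=
  .query ∅ fun v => greedyMaxLoop c B tie (Fintype.card V) ∅ v ∅ v Finset.univ

/-! ### The stochastic multi-agent environment -/

/-- `X ω i t A` is the reward that agent `i` would receive at time `t` for the action `A`. The
reward functions of different pairs (agent, time) are independent; for a fixed permitted action,
all rewards have the same law on `[0,1]`, with mean `f A`. Nothing is assumed about the dependence
between the rewards of different actions for the same agent and time. -/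
structure IsRewardModel {V I Ω : Type*} [MeasurableSpace Ω] (μ : Measure Ω)
    (𝕊 : Set (Finset V)) (f : Finset V → ℝ) (X : Ω → I → ℕ → Finset V → ℝ) : Prop where
  measurable : ∀ i t, ∀ A ∈ 𝕊, Measurable fun ω => X ω i t A
  mem_Icc : ∀ ω i t, ∀ A ∈ 𝕊, X ω i t A ∈ Set.Icc (0 : ℝ) 1
  indep : iIndepFun (fun (p : I × ℕ) (ω : Ω) (A : 𝕊) => X ω p.1 p.2 A) μ
  identDistrib : ∀ A ∈ 𝕊, ∀ i t i' t',
    IdentDistrib (fun ω => X ω i t A) (fun ω => X ω i' t' A) μ μ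
  mean : ∀ A ∈ 𝕊, ∀ i t, ∫ ω, X ω i t A ∂μ = f A

/-- `M ω j` is the random set of `m` agents which communicate in round `j`. Its law is arbitrary
(for instance, uniform and independent over the rounds), but it is independent of the rewards. -/
structure IsAgentSelection {V I Ω : Type*} [MeasurableSpace Ω] (μ : Measure Ω)
    (𝕊 : Set (Finset V)) (X : Ω → I → ℕ → Finset V → ℝ) (m : ℕ)
    (M : Ω → ℕ → Finset I) : Prop where
  measurable : ∀ j, Measurable fun ω => M ω j
  card_eq : ∀ ω j, (M ω j).card = m
  indep : IndepFun M (fun (ω : Ω) (p : I × ℕ) (A : 𝕊) => X ω p.1 p.2 A) μ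

/-! ### The algorithm C-MA-MAB -/

/-- The number of times
`r⋆ᵢ = ⌈m⁻¹ (δ √(log T) (T m / ψ)^(1/(β+1)))^((2+2β)/(3+β))⌉`
each agent plays each queried action. -/
def explorationLength (T m : ℕ) (β ψ δ : ℝ) : ℕ :=
  ⌈(m : ℝ)⁻¹ * (δ * √(Real.log T) * (T * m / ψ) ^ (1 / (β + 1))) ^ ((2 + 2 * β) / (3 + β))⌉₊

/-- The mean of the rewards of agent `i` for the action `A` in the `j`-th block of `r` time
steps. -/
def localMean {V I : Type*} (x : I → ℕ → Finset V → ℝ) (r j : ℕ) (A : Finset V) (i : I) : ℝ :=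
  (∑ s ∈ Finset.range r, x i (j * r + s) A) / r

/-- The mean over the communicating agents of their local means. -/
def serverMean {V I : Type*} (x : I → ℕ → Finset V → ℝ) (r j : ℕ) (A : Finset V)
    (M : Finset I) : ℝ :=
  (∑ i ∈ M, localMean x r j A i) / M.card

/-- The state of the offline algorithm run by the server after `j` rounds, for a realization `x` of
the rewards and `M` of the communicating agents. -/
def serverState {V I : Type*} (alg : OracleAlgorithm V) (r : ℕ) (x : I → ℕ → Finset V → ℝ)
    (M : ℕ → Finset I) : ℕ → OracleAlgorithm V
  | 0 => alg
  | j + 1 =>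
      (serverState alg r x M j).feed
        (serverMean x r j (serverState alg r x M j).action (M j))

/-- The action which C-MA-MAB makes every agent play at time `t = 0, 1, 2, …`: during the block
`[j r, (j + 1) r)` this is the `j`-th queried action, and the output `Θ` of the offline algorithm
after it has stopped. -/
def playedAction {V I : Type*} (alg : OracleAlgorithm V) (r : ℕ) (x : I → ℕ → Finset V → ℝ)
    (M : ℕ → Finset I) (t : ℕ) : Finset V :=
  (serverState alg r x M (t / r)).action

/-- The rounds in which the selected agents communicate: those in which the offline algorithm makes
a query. -/
def communicationRounds {V I : Type*} (alg : OracleAlgorithm V) (r : ℕ)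
    (x : I → ℕ → Finset V → ℝ) (M : ℕ → Finset I) : Set ℕ :=
  {j | (serverState alg r x M j).IsQuerying}

/-- The cumulative `α`-regret of agent `i` over the horizon `T`, relative to the action `Sopt`. -/
def regret {V I : Type*} (α : ℝ) (alg : OracleAlgorithm V) (r : ℕ) (x : I → ℕ → Finset V → ℝ)
    (M : ℕ → Finset I) (Sopt : Finset V) (i : I) (T : ℕ) : ℝ :=
  ∑ t ∈ Finset.range T, (α * x i t Sopt - x i t (playedAction alg r x M t))

/-- The exploration length of C-MA-MAB with Greedy+Max, that is for the resilience parameters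
`β = γ = 0`, `ψ = n K̃`, `δ = 1/2 + K̃ + 2 q` (so that no error parameter `ε⋆` is left). -/
def greedyMaxExplorationLength {V : Type*} [Fintype V] (c : V → ℝ) (B : ℝ) (T m : ℕ) : ℕ :=
  explorationLength T m 0 (Fintype.card V * sizeBound c B)
    (1 / 2 + sizeBound c B + 2 * budgetRatio c B)

end

end CMAMAB

open CMAMAB

/-!
The regret splits into exploration and exploitation. The offline algorithm makes at most `N = 1 +
n ⌊K̃⌋ ≤ 2 n K̃` queries, because every pass of Greedy+Max adds an arm to a feasible set and
queries at most `n` sets (`ensures_feasible_greedyMax`). So the exploration lasts at most `N r`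
steps and costs at most `N r`.

During the exploitation every step costs what the output `Θ` lacks to `f(S⋆) / 2`. If all answers
are correct up to `ε`, this is at most `(2 q + 2) ε` (`ensures_approx_greedyMax`). Let `o` be the
most expensive arm of `S⋆`. As long as the greedy set `G` leaves room for `o`, all of `S⋆ \ G` is
available. Either `f(G ∪ {o}) ≥ f(S⋆) / 2` in one of these passes, and then the best augmentation
seen is good enough, or, by submodularity, `S⋆ \ (G ∪ {o})`, whose cost is at most `B - c(o)`, is
worth another `f(S⋆) / 2` on top of `G`. In the second case every pass gains at least the fraction
`c(a) / (B - c(o))` of `f(S⋆) / 2 - 2 q ε` in observed value (`density_gain`), so that the first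
greedy set of cost more than `B - c(o)` is good enough. The gains are those of the observed
values, which telescope, so the errors do not add up over the passes.

The set queried in a block, and the agents selected in it, depend only on the selections and on
the rewards of earlier blocks. They are therefore independent of the rewards in the block
(`integral_choice_block`), and Hoeffding's inequality for a fixed set and fixed agents bounds the
probability of a wrong answer by `2 exp (-2 m r ε²)` (`measureReal_deviation_le`), without a union
bound over the sets. For the same reason the expected reward of an action is the expectation of
its value (`integral_reward_playedAction`). This needs the decisions of Greedy+Max to be
measurable functions of the answers (`measurable_run_greedyMax`).

Altogether the regret is at most `N r + T ((2 q + 2) ε + 2 N exp (-2 m r ε²))`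
(`integral_regret_le`). Since `m r ≥ (δ √(log T) T m / ψ) ^ (2 / 3)`, a deviation has probability
at most `2 / T²` for `ε = √(log T) (δ √(log T) T m / ψ) ^ (-1 / 3)`, and `exploration_balance`
shows that the total has the claimed order.
-/

namespace CMAMAB

open OracleAlgorithm

/-! ### Guarantees along admissible answers -/

/-- `alg.Ensures acc Q P k`: whenever every answer `x` to a query `A` satisfies `acc A x`, the
algorithm makes at most `k` queries, all of them of sets in `Q`, and its output is in `P`. -/
inductive OracleAlgorithm.Ensures {V : Type*} (acc : Finset V → ℝ → Prop)
    (Q P : Finset V → Prop) : ℕ → OracleAlgorithm V → Prop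
  | output (k : ℕ) (Θ : Finset V) (h : P Θ) : Ensures acc Q P k (.output Θ)
  | query (k : ℕ) (A : Finset V) (next : ℝ → OracleAlgorithm V) (hA : Q A)
      (h : ∀ x, acc A x → Ensures acc Q P k (next x)) : Ensures acc Q P (k + 1) (.query A next)

theorem OracleAlgorithm.Ensures.mono {V : Type*} {acc : Finset V → ℝ → Prop}
    {Q P : Finset V → Prop} {k k' : ℕ} {alg : OracleAlgorithm V} (h : Ensures acc Q P k alg)
    (hk : k ≤ k') : Ensures acc Q P k' alg := by
  induction h generalizing k' with
  | output k Θ h => exact .output _ _ h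
  | query k A next hA _ ih =>
    obtain ⟨k', rfl⟩ : ∃ l, k' = l + 1 := ⟨k' - 1, by omega⟩
    exact .query _ _ _ hA fun x hx => ih x hx (by omega)

/-- After the values of `G ∪ {e}` have been queried for all `e` in `l`, the table is admissible at
all these `e`, and still at those where it was so before, which are described by `D`. -/
theorem ensures_queryEach {V : Type*} [DecidableEq V] {acc : Finset V → ℝ → Prop}
    {Q P : Finset V → Prop} {k : ℕ} {G : Finset V} {K : (V → ℝ) → OracleAlgorithm V}
    (l : List V) (vals : V → ℝ) (D : V → Prop) (hQ : ∀ e ∈ l, Q (insert e G))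
    (hD : ∀ e, D e → acc (insert e G) (vals e))
    (hK : ∀ v : V → ℝ, (∀ e, D e ∨ e ∈ l → acc (insert e G) (v e)) → Ensures acc Q P k (K v)) :
    Ensures acc Q P (k + l.length) (queryEach G l vals K) := by
  induction l generalizing vals D with
  | nil => exact hK vals (by simpa using hD)
  | cons e l ih =>
    refine .query _ _ _ (hQ e (by simp)) fun x hx => ih _ (fun e' => D e' ∨ e' = e) ?_ ?_ ?_
    · exact fun e' he' => hQ e' (by simp [he'])
    · intro e' he'
      by_cases h : e' = e
      · subst h; simpa using hx
      · simpa [Function.update_of_ne h] using hD e' (by tauto)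
    · exact fun v hv => hK v fun e' he' => hv e' (by simp at he'; tauto)

/-! ### One pass of Greedy+Max -/

theorem setCost_insert {V : Type*} [DecidableEq V] (c : V → ℝ) {G : Finset V} {e : V}
    (he : e ∉ G) : setCost c (insert e G) = setCost c G + c e := by
  rw [setCost, Finset.sum_insert he, setCost, add_comm]

theorem tie_mem_maximizers {V : Type*} {tie : Finset V → V}
    (htie : ∀ s : Finset V, s.Nonempty → tie s ∈ s) {U : Finset V} (hU : U.Nonempty) (g : V → ℝ) :
    tie (maximizers U g) ∈ U ∧ ∀ e ∈ U, g e ≤ g (tie (maximizers U g)) := by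
  classical
  obtain ⟨e, he, hmax⟩ := U.exists_max_image g hU
  have := htie (maximizers U g) ⟨e, by simp only [maximizers, Finset.mem_filter]; exact ⟨he, hmax⟩⟩
  simpa only [maximizers, Finset.mem_filter] using this

/-- As costs are positive, removing from `U` what no longer fits after each pass keeps `U` equal to
the set of all arms outside `G` that fit. -/
theorem mem_available_step {V : Type*} [DecidableEq V] {c : V → ℝ} {B : ℝ} (hc : ∀ v, 0 < c v)
    {G U : Finset V} (hU : ∀ e, e ∈ U ↔ e ∉ G ∧ setCost c G + c e ≤ B) {a : V} (ha : a ∈ U)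
    (e : V) :
    e ∈ (U.erase a).filter (fun e => setCost c (insert a G) + c e ≤ B) ↔
      e ∉ insert a G ∧ setCost c (insert a G) + c e ≤ B := by
  have h := setCost_insert c ((hU a).1 ha).1
  have := hc a
  simp only [Finset.mem_filter, Finset.mem_erase, hU, Finset.mem_insert, not_or]
  refine ⟨fun ⟨⟨h1, h2, _⟩, h3⟩ => ⟨⟨h1, h2⟩, h3⟩, fun ⟨⟨h1, h2⟩, h3⟩ => ⟨⟨h1, h2, ?_⟩, h3⟩⟩
  linarith

/-- Induction over the passes of Greedy+Max. An invariant which every pass preserves, and which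
implies `P` of the best set once no arm fits any more, yields `P` of the output. If feasible sets
have at most `L` arms, then at most `L - |G|` passes remain, with at most `n` queries each. -/
theorem ensures_greedyMaxLoop {V : Type*} [Fintype V] [DecidableEq V] {c : V → ℝ} {B : ℝ}
    {tie : Finset V → V} (hc : ∀ v, 0 < c v) (htie : ∀ s : Finset V, s.Nonempty → tie s ∈ s)
    {L : ℕ} (hL : ∀ A ∈ knapsack c B, A.card ≤ L) {acc : Finset V → ℝ → Prop}
    (Inv : Finset V → ℝ → Finset V → ℝ → Prop) {P : Finset V → Prop}
    (hstep : ∀ (G : Finset V) (vG : ℝ) (S : Finset V) (vS : ℝ) (U : Finset V) (vals : V → ℝ)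
      (s a : V), Inv G vG S vS → (∀ e, e ∈ U ↔ e ∉ G ∧ setCost c G + c e ≤ B) →
      (∀ e ∈ U, acc (insert e G) (vals e)) → s ∈ U → (∀ e ∈ U, vals e ≤ vals s) → a ∈ U →
      (∀ e ∈ U, (vals e - vG) / c e ≤ (vals a - vG) / c a) →
      Inv (insert a G) (vals a) (if vS < vals s then insert s G else S) (max vS (vals s)))
    (hend : ∀ (G : Finset V) (vG : ℝ) (S : Finset V) (vS : ℝ), Inv G vG S vS →
      (∀ e, ¬ (e ∉ G ∧ setCost c G + c e ≤ B)) → P S)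
    (p : ℕ) (G : Finset V) (vG : ℝ) (S : Finset V) (vS : ℝ) (U : Finset V) (hp : U.card ≤ p)
    (hU : ∀ e, e ∈ U ↔ e ∉ G ∧ setCost c G + c e ≤ B) (hInv : Inv G vG S vS) :
    Ensures acc (· ∈ knapsack c B) P (Fintype.card V * (L - G.card))
      (greedyMaxLoop c B tie p G vG S vS U) := by
  have hfit : ∀ {G U : Finset V}, (∀ e, e ∈ U ↔ e ∉ G ∧ setCost c G + c e ≤ B) → ∀ e ∈ U,
      insert e G ∈ knapsack c B := fun hU e he => by
    rw [knapsack, Set.mem_ofPred_eq, setCost_insert c ((hU e).1 he).1]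
    exact ((hU e).1 he).2
  induction p generalizing G vG S vS U with
  | zero =>
    obtain rfl : U = ∅ := by simpa using hp
    exact .output _ _ (hend G vG S vS hInv (by simpa using hU))
  | succ p ih =>
    rw [greedyMaxLoop]
    by_cases hU0 : U = ∅
    · subst hU0
      simpa using .output _ _ (hend G vG S vS hInv (by simpa using hU))
    have hne := Finset.nonempty_iff_ne_empty.2 hU0
    obtain ⟨e₀, he₀⟩ := hne
    have hcard : ∀ e ∈ U, (insert e G).card = G.card + 1 :=
      fun e he => Finset.card_insert_of_notMem ((hU e).1 he).1
    have hGL : G.card + 1 ≤ L := hcard e₀ he₀ ▸ hL _ (hfit hU _ he₀)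
    rw [if_neg hU0]
    refine (ensures_queryEach (k := Fintype.card V * (L - (G.card + 1))) _ _ (fun _ => False)
      (fun e he => hfit hU e (by simpa using he)) (by simp) fun vals hvals => ?_).mono ?_
    · obtain ⟨hs, hs'⟩ := tie_mem_maximizers htie ⟨e₀, he₀⟩ vals
      obtain ⟨ha, ha'⟩ := tie_mem_maximizers htie ⟨e₀, he₀⟩ fun e => (vals e - vG) / c e
      have key := hstep G vG S vS U vals _ _ hInv hU
        (fun e he => hvals e (Or.inr (by simpa using he))) hs hs' ha ha'
      have hlt : ∀ a ∈ U, ((U.erase a).filter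
          fun e => setCost c (insert a G) + c e ≤ B).card ≤ p := fun a ha => by
        have := Finset.card_filter_le (U.erase a) fun e => setCost c (insert a G) + c e ≤ B
        have := Finset.card_erase_lt_of_mem ha
        omega
      dsimp only
      rw [← hcard _ ha]
      split_ifs with hif
      · rw [if_pos hif, max_eq_right hif.le] at key
        exact ih _ _ _ _ _ (hlt _ ha) (mem_available_step hc hU ha) key
      · rw [if_neg hif, max_eq_left (not_lt.1 hif)] at key
        exact ih _ _ _ _ _ (hlt _ ha) (mem_available_step hc hU ha) key
    · obtain ⟨d, hd⟩ : ∃ d, L = G.card + 1 + d := ⟨L - (G.card + 1), by omega⟩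
      have h1 : L - (G.card + 1) = d := by omega
      have h2 : L - G.card = d + 1 := by omega
      rw [h1, h2, Finset.length_toList, mul_add, mul_one]
      exact Nat.add_le_add_left (Finset.card_le_univ U) _

/-! ### Feasibility and the approximation guarantee of Greedy+Max -/

/-- Whatever the answers are, Greedy+Max queries only feasible sets, at most `1 + n L` times if
feasible sets have at most `L` arms, and its output is feasible. -/
theorem ensures_feasible_greedyMax {V : Type*} [Fintype V] [DecidableEq V] {c : V → ℝ} {B : ℝ}
    {tie : Finset V → V} (hB : 0 ≤ B) (hc : ∀ v, 0 < c v ∧ c v ≤ B)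
    (htie : ∀ s : Finset V, s.Nonempty → tie s ∈ s)
    {L : ℕ} (hL : ∀ A ∈ knapsack c B, A.card ≤ L) :
    Ensures (fun _ _ => True) (· ∈ knapsack c B) (· ∈ knapsack c B) (Fintype.card V * L + 1)
      (greedyMax c B tie) := by
  have h0 : (∅ : Finset V) ∈ knapsack c B := by simpa [knapsack, setCost] using hB
  refine .query _ _ _ h0 fun v _ => ?_
  refine ensures_greedyMaxLoop (fun v => (hc v).1) htie hL (fun _ _ S _ => S ∈ knapsack c B)
    ?_ ?_ _ ∅ _ _ _ _ le_rfl ?_ h0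
  · intro G vG S vS U vals s a hS hU _ hs _ _ _
    split_ifs
    · rw [knapsack, Set.mem_ofPred_eq, setCost_insert c ((hU s).1 hs).1]
      exact ((hU s).1 hs).2
    · exact hS
  · exact fun _ _ _ _ h _ => h
  · simp [setCost, fun v => (hc v).2]

theorem IsSubmodular.union_sub_le {V : Type*} [DecidableEq V] {f : Finset V → ℝ}
    (hf : IsSubmodular f) {G A : Finset V} (hGA : G ⊆ A) (R : Finset V) (hR : Disjoint R A) :
    f (A ∪ R) - f A ≤ ∑ e ∈ R, (f (insert e G) - f G) := by
  induction R using Finset.induction_on with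
  | empty => simp
  | insert e R he ih =>
    rw [Finset.disjoint_insert_left] at hR
    have h1 := ih hR.2
    have h2 := hf G (A ∪ R) (hGA.trans Finset.subset_union_left) e (by simp [he, hR.1])
    rw [Finset.sum_insert he, Finset.union_insert]
    linarith

/-- The density step: let `o` be an arm, and suppose that `G ∪ {o}` has less than half the value of
`S`, where `D > 0` bounds the cost of `S \ {o}`, the arms of `S` outside `G` are available, and the
values are observed up to `ε`. Then the observed gain of the arm `a` of largest observed density is
at least the fraction `c(a) / D` of `f(S) / 2` minus the errors. -/
theorem density_gain {V : Type*} [DecidableEq V] {c : V → ℝ} (hc : ∀ v, 0 < c v)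
    {f : Finset V → ℝ} (hmono : Monotone f) (hsub : IsSubmodular f) {ε h q D vG : ℝ}
    {G S U : Finset V} {vals : V → ℝ} {o a : V}
    (hhalf : f (insert o G) < f S / 2) (hS : 0 ≤ f S)
    (hD : setCost c (S.erase o) ≤ D) (hq : ((S.erase o).card : ℝ) ≤ q) (hε : 0 ≤ ε)
    (hU : ∀ e ∈ S, e ∉ G → e ∈ U) (hvals : ∀ e ∈ U, |vals e - f (insert e G)| ≤ ε)
    (hvG : |vG - f G| ≤ ε)
    (ha : ∀ e ∈ U, (vals e - vG) / c e ≤ (vals a - vG) / c a)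
    (hh : h = f S / 2 - 2 * q * ε) (hh0 : 0 < h) :
    0 < D ∧ c a * h ≤ D * (vals a - vG) := by
  set R := S \ insert o G with hRdef
  have hRS : R ⊆ S.erase o := by
    intro e he
    simp only [hRdef, Finset.mem_sdiff, Finset.mem_insert, not_or, Finset.mem_erase] at he ⊢
    tauto
  have h1 := hsub.union_sub_le (Finset.subset_insert o G) R Finset.sdiff_disjoint
  have h2 : f S ≤ f (insert o G ∪ R) := hmono (by
    rw [hRdef, Finset.union_sdiff_self_eq_union]; exact Finset.subset_union_right)
  have hRU : ∀ e ∈ R, e ∈ U := fun e he => by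
    simp only [hRdef, Finset.mem_sdiff, Finset.mem_insert, not_or] at he
    exact hU e he.1 he.2.2
  have hRne : R.Nonempty := by
    by_contra hne
    rw [Finset.not_nonempty_iff_eq_empty] at hne
    rw [hne] at h1 h2
    simp at h1 h2
    linarith
  have hcR : 0 < setCost c R := Finset.sum_pos (fun e _ => hc e) hRne
  have hcD : setCost c R ≤ D :=
    (Finset.sum_le_sum_of_subset_of_nonneg hRS fun e _ _ => (hc e).le).trans hD
  have hcard : (R.card : ℝ) ≤ q := le_trans (by exact_mod_cast Finset.card_le_card hRS) hq
  have h3 : ∑ e ∈ R, (f (insert e G) - f G - 2 * ε) ≤ ∑ e ∈ R, (vals e - vG) :=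
    Finset.sum_le_sum fun e he => by
      have h4 := abs_le.1 (hvals e (hRU e he))
      have h5 := abs_le.1 hvG
      linarith
  have h4 : c a * ∑ e ∈ R, (vals e - vG) ≤ setCost c R * (vals a - vG) := by
    rw [setCost, Finset.mul_sum, Finset.sum_mul]
    refine Finset.sum_le_sum fun e he => ?_
    have := ha e (hRU e he)
    rw [div_le_div_iff₀ (hc e) (hc a)] at this
    linarith
  rw [Finset.sum_sub_distrib, Finset.sum_const, nsmul_eq_mul] at h3
  have h5 : h ≤ ∑ e ∈ R, (vals e - vG) := by
    have := mul_le_mul_of_nonneg_right hcard hε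
    linarith
  have h6 : c a * h ≤ setCost c R * (vals a - vG) :=
    (mul_le_mul_of_nonneg_left h5 (hc a).le).trans h4
  have h7 : 0 ≤ vals a - vG := by
    by_contra hneg
    have := mul_neg_of_pos_of_neg hcR (not_le.1 hneg)
    have := mul_pos (hc a) hh0
    linarith
  exact ⟨hcR.trans_le hcD, h6.trans (mul_le_mul_of_nonneg_right hcD h7)⟩

/-- If all answers are correct up to `ε`, then the output of Greedy+Max has at least half the value
of a feasible set `Sopt`, up to an error `(2 q + 2) ε`. -/
theorem ensures_approx_greedyMax {V : Type*} [Fintype V] [DecidableEq V] {c : V → ℝ} {B : ℝ}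
    {tie : Finset V → V} (hc : ∀ v, 0 < c v ∧ c v ≤ B)
    (htie : ∀ s : Finset V, s.Nonempty → tie s ∈ s)
    {L : ℕ} {q : ℝ} (hL : ∀ A ∈ knapsack c B, A.card ≤ L)
    (hq : ∀ A ∈ knapsack c B, (A.card : ℝ) ≤ q)
    {f : Finset V → ℝ} (hmono : Monotone f) (hsub : IsSubmodular f) (hf0 : 0 ≤ f ∅)
    {Sopt : Finset V} (hSopt : Sopt ∈ knapsack c B) {ε : ℝ} (hε : 0 ≤ ε) :
    Ensures (fun A x => |x - f A| ≤ ε) (· ∈ knapsack c B)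
      (fun Θ => f Sopt / 2 - (2 * q + 2) * ε ≤ f Θ) (Fintype.card V * L + 1)
      (greedyMax c B tie) := by
  have hq0 : 0 ≤ q := (Nat.cast_nonneg _).trans (hq _ hSopt)
  have hqε : 0 ≤ q * ε := mul_nonneg hq0 hε
  have hf0S : f ∅ ≤ f Sopt := hmono (Finset.empty_subset _)
  have h0 : (∅ : Finset V) ∈ knapsack c B :=
    (Finset.sum_le_sum_of_subset_of_nonneg (Finset.empty_subset Sopt)
      fun v _ _ => (hc v).1.le).trans hSopt
  refine .query _ _ _ h0 fun v₀ hv₀ => ?_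
  obtain ⟨h, hh⟩ : ∃ h, h = f Sopt / 2 - 2 * q * ε := ⟨_, rfl⟩
  -- Either a set of sufficient observed value has been found, or the greedy solution still leaves
  -- room for the most expensive arm `o` of `Sopt` and has gained enough per unit of cost.
  refine ensures_greedyMaxLoop (fun v => (hc v).1) htie hL
    (fun G vG S vS => |vG - f G| ≤ ε ∧ |vS - f S| ≤ ε ∧ vG ≤ vS ∧
      (h - ε ≤ vS ∨ 0 < h ∧ ∃ o ∈ Sopt, (∀ e ∈ Sopt, c e ≤ c o) ∧ setCost c G ≤ B - c o ∧
        setCost c G * h ≤ (B - c o) * (vG - v₀)))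
    ?_ ?_ _ ∅ _ _ _ _ le_rfl ?_ ⟨hv₀, hv₀, le_rfl, ?_⟩
  · rintro G vG S vS U vals s a ⟨hG, hS, hGS, hInv⟩ hU hvals hs hs' ha ha'
    refine ⟨hvals a ha, ?_, (hs' a ha).trans (le_max_right _ _), ?_⟩
    · split_ifs with hif
      · rw [max_eq_right hif.le]; exact hvals s hs
      · rw [max_eq_left (not_lt.1 hif)]; exact hS
    rcases hInv with hInv | ⟨hh0, o, hoS, hmax, hGo, hgain⟩
    · exact Or.inl (hInv.trans (le_max_left _ _))
    have havail : ∀ e ∈ Sopt, e ∉ G → e ∈ U := fun e he heG =>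
      (hU e).2 ⟨heG, by linarith [hmax e he]⟩
    by_cases hhalf : f Sopt / 2 ≤ f (insert o G)
    · left
      by_cases hoG : o ∈ G
      · rw [Finset.insert_eq_of_mem hoG] at hhalf
        refine le_trans ?_ (hGS.trans (le_max_left _ _))
        linarith [(abs_le.1 hG).1]
      · have hoU := havail o hoS hoG
        refine le_trans ?_ ((hs' o hoU).trans (le_max_right _ _))
        linarith [(abs_le.1 (hvals o hoU)).1]
    · have hD : setCost c (Sopt.erase o) ≤ B - c o := by
        have h1 : setCost c (Sopt.erase o) + c o = setCost c Sopt := Finset.sum_erase_add _ _ hoS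
        have h2 : setCost c Sopt ≤ B := hSopt
        linarith
      have hcard : ((Sopt.erase o).card : ℝ) ≤ q :=
        le_trans (by exact_mod_cast Finset.card_le_card (Finset.erase_subset _ _)) (hq _ hSopt)
      obtain ⟨hD0, hstep⟩ := density_gain (fun v => (hc v).1) hmono hsub (not_le.1 hhalf)
        (hf0.trans hf0S) hD hcard hε havail hvals hG ha' hh hh0
      have hcost := setCost_insert c ((hU a).1 ha).1
      have hgain' : setCost c (insert a G) * h ≤ (B - c o) * (vals a - v₀) := by
        rw [hcost]; nlinarith
      by_cases hfit : setCost c (insert a G) ≤ B - c o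
      · exact Or.inr ⟨hh0, o, hoS, hmax, hfit, hgain'⟩
      · left
        have h1 : (B - c o) * h ≤ (B - c o) * (vals a - v₀) :=
          (mul_le_mul_of_nonneg_right (not_le.1 hfit).le hh0.le).trans hgain'
        have h2 := le_of_mul_le_mul_left h1 hD0
        refine le_trans ?_ ((hs' a ha).trans (le_max_right _ _))
        linarith [(abs_le.1 hv₀).1]
  · rintro G vG S vS ⟨hG, hS, hGS, hInv⟩ hend
    suffices h - ε ≤ vS by linarith [(abs_le.1 hS).2]
    rcases hInv with hInv | ⟨hh0, o, hoS, hmax, hGo, hgain⟩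
    · exact hInv
    · have hsubset : Sopt ⊆ G := fun e he => by
        by_contra heG
        exact hend e ⟨heG, by linarith [hmax e he]⟩
      linarith [hmono hsubset, (abs_le.1 hG).1]
  · simp [setCost, fun v => (hc v).2]
  · rcases le_or_gt h 0 with hh0 | hh0
    · left
      linarith [(abs_le.1 hv₀).1]
    rcases Sopt.eq_empty_or_nonempty with rfl | hne
    · left
      linarith [(abs_le.1 hv₀).1]
    · obtain ⟨o, ho, hmax⟩ := Sopt.exists_max_image c hne
      exact Or.inr ⟨hh0, o, ho, hmax, by simp [setCost, (hc o).2], by simp [setCost]⟩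

/-! ### Runs of an oracle algorithm -/

/-- The state of an algorithm after the answers `x 0, …, x (k - 1)`. -/
def OracleAlgorithm.run {V : Type*} : OracleAlgorithm V → (ℕ → ℝ) → ℕ → OracleAlgorithm V
  | alg, _, 0 => alg
  | alg, x, k + 1 => run (alg.feed (x 0)) (fun j => x (j + 1)) k

theorem run_succ {V : Type*} (alg : OracleAlgorithm V) (x : ℕ → ℝ) (k : ℕ) :
    run alg x (k + 1) = (run alg x k).feed (x k) := by
  induction k generalizing alg x with
  | zero => rfl
  | succ k ih => rw [run, ih, run]

theorem run_congr {V : Type*} (alg : OracleAlgorithm V) {x y : ℕ → ℝ} {k : ℕ}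
    (h : ∀ j < k, x j = y j) : run alg x k = run alg y k := by
  induction k with
  | zero => rfl
  | succ k ih => rw [run_succ, run_succ, ih fun j hj => h j (by omega), h k (by omega)]

theorem run_output {V : Type*} (Θ : Finset V) (x : ℕ → ℝ) (k : ℕ) :
    run (.output Θ) x k = .output Θ := by
  induction k generalizing x with
  | zero => rfl
  | succ k ih => exact ih _

/-- After `k` admissible answers the algorithm has stopped, with an output in `P`. -/
theorem OracleAlgorithm.Ensures.run_eq_output {V : Type*} {acc : Finset V → ℝ → Prop}
    {Q P : Finset V → Prop} {k : ℕ} {alg : OracleAlgorithm V} (h : Ensures acc Q P k alg)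
    {x : ℕ → ℝ} (hx : ∀ j < k, acc (run alg x j).action (x j)) {l : ℕ} (hl : k ≤ l) :
    ∃ Θ, run alg x l = .output Θ ∧ P Θ := by
  induction h generalizing x l with
  | output k Θ h => exact ⟨Θ, run_output Θ x l, h⟩
  | query k A next hA _ ih =>
    obtain ⟨l, rfl⟩ : ∃ l', l = l' + 1 := ⟨l - 1, by omega⟩
    exact ih (x 0) (hx 0 (by omega)) (fun j hj => hx (j + 1) (by omega)) (by omega)

theorem OracleAlgorithm.Ensures.action_mem {V : Type*} {Q : Finset V → Prop} {k : ℕ}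
    {alg : OracleAlgorithm V} (h : Ensures (fun _ _ => True) Q Q k alg) (x : ℕ → ℝ) (l : ℕ) :
    Q (run alg x l).action := by
  induction h generalizing x l with
  | output k Θ h => rwa [run_output]
  | query k A next hA _ ih =>
    cases l with
    | zero => exact hA
    | succ l => exact ih (x 0) trivial _ l

theorem serverState_eq_run {V I : Type*} (alg : OracleAlgorithm V) (r : ℕ)
    (x : I → ℕ → Finset V → ℝ) (M : ℕ → Finset I) (j : ℕ) :
    serverState alg r x M j =
      run alg (fun j => serverMean x r j (serverState alg r x M j).action (M j)) j := by
  induction j with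
  | zero => rfl
  | succ j ih => rw [run_succ, ← ih, serverState]

/-! ### Measurability of the decisions -/

/-- Only functions that are actually selected need to be measurable; rewards of infeasible actions,
for instance, are not assumed to be. -/
theorem measurable_of_countable_choice {Ω D E : Type*} [MeasurableSpace Ω] [MeasurableSpace D]
    [MeasurableSingletonClass D] [Countable D] [MeasurableSpace E] {d : Ω → D} (hd : Measurable d)
    {g : D → Ω → E} (hg : ∀ ω, Measurable (g (d ω))) : Measurable fun ω => g (d ω) ω := by
  intro s hs
  have : (fun ω => g (d ω) ω) ⁻¹' s = ⋃ y, (d ⁻¹' {y} ∩ g y ⁻¹' s) := by ext; simp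
  rw [this]
  refine MeasurableSet.iUnion fun y => ?_
  by_cases hy : ∃ ω, d ω = y
  · obtain ⟨ω, rfl⟩ := hy
    exact (hd (measurableSet_singleton _)).inter (hg ω hs)
  · convert MeasurableSet.empty
    ext ω
    simp only [Set.mem_inter_iff, Set.mem_preimage, Set.mem_singleton_iff, Set.mem_empty_iff_false,
      iff_false, not_and]
    exact fun h => absurd ⟨ω, h⟩ hy

/-- A family of algorithms is measurable if at every stage the set under consideration is a jointly
measurable function of the parameter and of the answers. -/
def MeasurableFamily {V Θ : Type*} [MeasurableSpace Θ] (a : Θ → OracleAlgorithm V) : Prop :=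
  ∀ k, Measurable fun p : Θ × (ℕ → ℝ) => (run (a p.1) p.2 k).action

namespace MeasurableFamily

variable {V Θ Θ' : Type*} [MeasurableSpace Θ] [MeasurableSpace Θ']

theorem comp {a : Θ → OracleAlgorithm V} (ha : MeasurableFamily a) {g : Θ' → Θ}
    (hg : Measurable g) : MeasurableFamily fun θ => a (g θ) := fun k =>
  (ha k).comp ((hg.comp measurable_fst).prodMk measurable_snd)

theorem output (A : Finset V) :
    MeasurableFamily fun _ : Θ => OracleAlgorithm.output A := fun k => by
  simp only [run_output]
  exact measurable_const

theorem query (A : Finset V) {next : Θ → ℝ → OracleAlgorithm V}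
    (h : MeasurableFamily fun p : Θ × ℝ => next p.1 p.2) :
    MeasurableFamily fun θ => OracleAlgorithm.query A (next θ) := fun k => by
  cases k with
  | zero => exact measurable_const
  | succ k =>
    have hg : Measurable fun p : Θ × (ℕ → ℝ) => ((p.1, p.2 0), fun j => p.2 (j + 1)) := by
      fun_prop
    exact (h k).comp hg

theorem countable_choice {D : Type*} [MeasurableSpace D] [MeasurableSingletonClass D] [Countable D]
    {d : Θ → D} (hd : Measurable d) {a : D → Θ → OracleAlgorithm V}
    (ha : ∀ y, MeasurableFamily (a y)) : MeasurableFamily fun θ => a (d θ) θ := fun k =>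
  measurable_of_countable_choice (d := fun p : Θ × (ℕ → ℝ) => d p.1) (hd.comp measurable_fst)
    (g := fun y p => (run (a y p.1) p.2 k).action) fun _ => ha _ k

theorem queryEach [DecidableEq V] (G : Finset V) {K : Θ → (V → ℝ) → OracleAlgorithm V}
    (hK : MeasurableFamily fun p : Θ × (V → ℝ) => K p.1 p.2) (l : List V) :
    MeasurableFamily fun p : Θ × (V → ℝ) => CMAMAB.queryEach G l p.2 (K p.1) := by
  induction l with
  | nil => exact hK
  | cons e l ih =>
    have hg : Measurable fun p : (Θ × (V → ℝ)) × ℝ => (p.1.1, Function.update p.1.2 e p.2) := by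
      refine (by fun_prop : Measurable fun p : (Θ × (V → ℝ)) × ℝ => p.1.1).prodMk ?_
      refine measurable_pi_iff.2 fun e' => ?_
      by_cases h : e' = e
      · subst h; simp only [Function.update_self]; fun_prop
      · simp only [Function.update_of_ne h]; fun_prop
    exact query _ (ih.comp hg)

end MeasurableFamily

theorem measurable_maximizers {V Θ : Type*} [Finite V] [MeasurableSpace Θ] (U : Finset V)
    {g : Θ → V → ℝ} (hg : ∀ e, Measurable fun θ => g θ e) :
    Measurable fun θ => maximizers U (g θ) := by
  refine measurable_finset_iff.2 fun e => ?_
  simp only [maximizers, Finset.mem_filter]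
  exact measurable_const.and (Measurable.forall fun e' => measurable_const.imp
    (measurableSet_setOfPred.1 (measurableSet_le (hg e') (hg e))))

theorem measurableFamily_greedyMaxLoop {V : Type*} [Fintype V] [DecidableEq V] (c : V → ℝ) (B : ℝ)
    (tie : Finset V → V) (p : ℕ) (G S U : Finset V) :
    MeasurableFamily fun v : ℝ × ℝ => greedyMaxLoop c B tie p G v.1 S v.2 U := by
  classical
  induction p generalizing G S U with
  | zero => exact .output S
  | succ p ih =>
    simp only [greedyMaxLoop]
    split_ifs with hU
    · exact .output S
    let _ : MeasurableSpace V := ⊤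
    refine MeasurableFamily.comp (g := fun v : ℝ × ℝ => (v, fun _ : V => (0 : ℝ)))
      (MeasurableFamily.queryEach G
        (K := fun v vals =>
          let s := tie (maximizers U vals)
          let a := tie (maximizers U fun e => (vals e - v.1) / c e)
          let G' := insert a G
          let U' := (U.erase a).filter fun e => setCost c G' + c e ≤ B
          if v.2 < vals s then greedyMaxLoop c B tie p G' (vals a) (insert s G) (vals s) U'
          else greedyMaxLoop c B tie p G' (vals a) S v.2 U') ?_ U.toList) (by fun_prop)
    -- All discrete decisions of a pass depend measurably on the observed values.
    have hs : Measurable fun q : (ℝ × ℝ) × (V → ℝ) => maximizers U q.2 :=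
      measurable_maximizers U fun e => by fun_prop
    have ha : Measurable fun q : (ℝ × ℝ) × (V → ℝ) =>
        maximizers U fun e => (q.2 e - q.1.1) / c e :=
      measurable_maximizers U fun e => by fun_prop
    refine MeasurableFamily.countable_choice (D := Finset V × Finset V) (hs.prodMk ha)
      (a := fun d q =>
          let s := tie d.1
          let a := tie d.2
          let G' := insert a G
          let U' := (U.erase a).filter fun e => setCost c G' + c e ≤ B
          if q.1.2 < q.2 s then greedyMaxLoop c B tie p G' (q.2 a) (insert s G) (q.2 s) U'
          else greedyMaxLoop c B tie p G' (q.2 a) S q.1.2 U') fun d => ?_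
    have hlt : Measurable fun q : (ℝ × ℝ) × (V → ℝ) => q.1.2 < q.2 (tie d.1) :=
      measurableSet_setOfPred.1 (measurableSet_lt (by fun_prop) (by fun_prop))
    have := MeasurableFamily.countable_choice hlt
      (a := fun b q =>
          let s := tie d.1
          let a := tie d.2
          let G' := insert a G
          let U' := (U.erase a).filter fun e => setCost c G' + c e ≤ B
          if b then greedyMaxLoop c B tie p G' (q.2 a) (insert s G) (q.2 s) U'
          else greedyMaxLoop c B tie p G' (q.2 a) S q.1.2 U') fun b => by
        by_cases hb : b
        · simp only [if_pos hb]
          exact (ih (insert (tie d.2) G) _ _).comp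
            (by fun_prop : Measurable fun q : (ℝ × ℝ) × (V → ℝ) => (q.2 (tie d.2), q.2 (tie d.1)))
        · simp only [if_neg hb]
          exact (ih (insert (tie d.2) G) S _).comp
            (by fun_prop : Measurable fun q : (ℝ × ℝ) × (V → ℝ) => (q.2 (tie d.2), q.1.2))
    convert this

theorem measurable_run_greedyMax {V : Type*} [Fintype V] [DecidableEq V] (c : V → ℝ) (B : ℝ)
    (tie : Finset V → V) (k : ℕ) :
    Measurable fun x : ℕ → ℝ => (run (greedyMax c B tie) x k).action := by
  have h : MeasurableFamily fun _ : Unit => greedyMax c B tie :=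
    .query _ ((measurableFamily_greedyMaxLoop c B tie _ _ _ _).comp
      (by fun_prop : Measurable fun p : Unit × ℝ => (p.2, p.2)))
  exact (h k).comp (by fun_prop : Measurable fun x : ℕ → ℝ => ((), x))

theorem measurable_serverMean {V I Ω : Type*} [MeasurableSpace Ω]
    {X : Ω → I → ℕ → Finset V → ℝ} {r j : ℕ} {A : Finset V}
    (hX : ∀ i, ∀ s < r, Measurable fun ω => X ω i (j * r + s) A) (ν : Finset I) :
    Measurable fun ω => serverMean (X ω) r j A ν := by
  unfold serverMean localMean
  refine Measurable.div_const (Finset.measurable_sum _ fun i _ => Measurable.div_const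
    (Finset.measurable_sum _ fun s hs => hX i s (Finset.mem_range.1 hs)) _) _

/-- The action in block `j` depends measurably on the selections and on the rewards before that
block. -/
theorem measurable_serverState_action {V I Ω : Type*} [MeasurableSpace Ω] [Finite V] [Finite I]
    {𝕊 : Set (Finset V)} {alg : OracleAlgorithm V}
    (halg : ∀ k, Measurable fun x : ℕ → ℝ => (run alg x k).action)
    (hmem : ∀ x k, (run alg x k).action ∈ 𝕊) {X : Ω → I → ℕ → Finset V → ℝ}
    {M : Ω → ℕ → Finset I} {r : ℕ} (hM : ∀ i, Measurable fun ω => M ω i) (j : ℕ)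
    (hX : ∀ i, ∀ t < j * r, ∀ A ∈ 𝕊, Measurable fun ω => X ω i t A) :
    Measurable fun ω => (serverState alg r (X ω) (M ω) j).action := by
  induction j using Nat.strong_induction_on with
  | _ j ih =>
    have hans : ∀ i < j, Measurable fun ω =>
        serverMean (X ω) r i (serverState alg r (X ω) (M ω) i).action (M ω i) := fun i hi => by
      have hle : (i + 1) * r ≤ j * r := Nat.mul_le_mul_right r hi
      rw [add_mul, one_mul] at hle
      refine measurable_of_countable_choice (D := Finset V × Finset I)
        (d := fun ω => ((serverState alg r (X ω) (M ω) i).action, M ω i))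
        ((ih i hi fun i' t ht => hX i' t (by omega)).prodMk (hM i))
        (g := fun d ω => serverMean (X ω) r i d.1 d.2) fun ω => ?_
      refine measurable_serverMean (fun i' s hs => hX i' _ (by omega) _ ?_) _
      rw [serverState_eq_run]
      exact hmem _ _
    have hrun : ∀ ω, serverState alg r (X ω) (M ω) j = run alg (fun i => if i < j then
        serverMean (X ω) r i (serverState alg r (X ω) (M ω) i).action (M ω i) else 0) j :=
      fun ω => by
        rw [serverState_eq_run]
        exact run_congr _ fun i hi => by rw [if_pos hi]
    simp only [hrun]
    refine (halg j).comp (measurable_pi_iff.2 fun i => ?_)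
    split_ifs with hi
    · exact hans i hi
    · exact measurable_const

/-! ### Selection by an independent decision -/

theorem indepFun_prodMk_left {Ω α β γ : Type*} [MeasurableSpace Ω] [MeasurableSpace α]
    [MeasurableSpace β] [MeasurableSpace γ] {μ : Measure Ω} [IsProbabilityMeasure μ] {f : Ω → α}
    {g : Ω → β} {h : Ω → γ} (hf : Measurable f) (hg : Measurable g) (hh : Measurable h)
    (h₁ : IndepFun f (fun ω => (g ω, h ω)) μ) (h₂ : IndepFun g h μ) :
    IndepFun (fun ω => (f ω, g ω)) h μ := by
  have hfg : IndepFun f g μ := h₁.comp measurable_id measurable_fst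
  have := Measure.isProbabilityMeasure_map (μ := μ) hf.aemeasurable
  have := Measure.isProbabilityMeasure_map (μ := μ) hg.aemeasurable
  have := Measure.isProbabilityMeasure_map (μ := μ) hh.aemeasurable
  rw [indepFun_iff_map_prod_eq_prod_map_map (by fun_prop) (by fun_prop)] at h₁ h₂ hfg ⊢
  rw [h₂, ← Measure.prodAssoc_prod] at h₁
  have h₃ := congrArg (Measure.map MeasurableEquiv.prodAssoc.symm) h₁
  rw [Measure.map_map (by fun_prop) (by fun_prop), MeasurableEquiv.map_symm_map] at h₃
  rw [hfg, ← h₃]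
  rfl

/-- If a decision `d` with finitely many values is independent of the random functions it selects
from, then the selected function has the mean that it would have for an independent copy. -/
theorem integral_choice {Ω D : Type*} {m₁ m₂ mΩ : MeasurableSpace Ω} {μ : Measure Ω}
    [IsProbabilityMeasure μ] (h₁ : m₁ ≤ mΩ) (hind : Indep m₁ m₂ μ)
    [MeasurableSpace D] [MeasurableSingletonClass D] [Finite D] {d : Ω → D}
    (hd : Measurable[m₁] d) {g : D → Ω → ℝ} (hg : ∀ ω, Measurable[m₂] (g (d ω)))
    (hint : ∀ ω, Integrable (g (d ω)) μ) :
    ∫ ω, g (d ω) ω ∂μ = ∫ ω, (∫ ω', g (d ω) ω' ∂μ) ∂μ := by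
  classical
  have := Fintype.ofFinite D
  -- Values which `d` does not take carry no information on `g`.
  set g' : D → Ω → ℝ := fun y => if y ∈ Set.range d then g y else 0 with hg'
  have hgd : ∀ ω, g (d ω) = g' (d ω) := fun ω => by simp [hg']
  have hg'm : ∀ y, Measurable[m₂] (g' y) := fun y => by
    by_cases hy : y ∈ Set.range d
    · obtain ⟨ω, rfl⟩ := hy
      rw [← hgd]; exact hg ω
    · simp only [hg', if_neg hy]; exact measurable_const
  have hg'i : ∀ y, Integrable (g' y) μ := fun y => by
    by_cases hy : y ∈ Set.range d
    · obtain ⟨ω, rfl⟩ := hy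
      rw [← hgd]; exact hint ω
    · simp only [hg', if_neg hy]; exact integrable_zero _ _ _
  have hind1 : ∀ y, Measurable[m₁] ((d ⁻¹' {y}).indicator fun _ => (1 : ℝ)) := fun y =>
    measurable_const.indicator (hd (measurableSet_singleton y))
  have hindi : ∀ y, Integrable ((d ⁻¹' {y}).indicator fun _ => (1 : ℝ)) μ := fun y =>
    (integrable_const 1).indicator (h₁ _ (hd (measurableSet_singleton y)))
  have hif : ∀ y, IndepFun ((d ⁻¹' {y}).indicator fun _ => (1 : ℝ)) (g' y) μ := fun y => by
    rw [IndepFun_iff_Indep]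
    exact indep_of_indep_of_le_left (indep_of_indep_of_le_right hind (hg'm y).comap_le)
      (hind1 y).comap_le
  have hsum : ∀ (G : D → ℝ) ω, G (d ω) = ∑ y, (d ⁻¹' {y}).indicator (fun _ => (1 : ℝ)) ω * G y :=
    fun G ω => by simp [Set.indicator_apply]
  simp only [hgd]
  calc ∫ ω, g' (d ω) ω ∂μ
      = ∫ ω, ∑ y, (d ⁻¹' {y}).indicator (fun _ => (1 : ℝ)) ω * g' y ω ∂μ :=
        integral_congr_ae (.of_forall fun ω => hsum (fun y => g' y ω) ω)
    _ = ∑ y, (∫ ω, (d ⁻¹' {y}).indicator (fun _ => (1 : ℝ)) ω ∂μ) * ∫ ω, g' y ω ∂μ := by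
        rw [integral_finsetSum (f := fun y ω => (d ⁻¹' {y}).indicator (fun _ => (1 : ℝ)) ω * g' y ω)
          _ fun y _ => (hif y).integrable_mul (hindi y) (hg'i y)]
        exact Finset.sum_congr rfl fun y _ => (hif y).integral_fun_mul_eq_mul_integral
          (hindi y).aestronglyMeasurable (hg'i y).aestronglyMeasurable
    _ = ∫ ω, ∑ y, (d ⁻¹' {y}).indicator (fun _ => (1 : ℝ)) ω * ∫ ω', g' y ω' ∂μ ∂μ := by
        rw [integral_finsetSum _ fun y _ => (hindi y).mul_const _]
        exact Finset.sum_congr rfl fun y _ => (integral_mul_const _ _).symm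
    _ = ∫ ω, (∫ ω', g' (d ω) ω' ∂μ) ∂μ :=
        integral_congr_ae (.of_forall fun ω => (hsum (fun y => ∫ ω', g' y ω' ∂μ) ω).symm)

/-! ### Concentration of the answer to a fixed query -/

/-- The event that the answer in block `j`, if `A` is queried and the agents in `ν` communicate,
deviates from the value of `A` by more than `ε`. -/
def deviationOf {V I Ω : Type*} (f : Finset V → ℝ) (X : Ω → I → ℕ → Finset V → ℝ) (r : ℕ) (ε : ℝ)
    (j : ℕ) (A : Finset V) (ν : Finset I) : Set Ω :=
  {ω | ε < |serverMean (X ω) r j A ν - f A|}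

/-- The event that the answer to the query made in block `j` deviates from the value of the queried
set by more than `ε`. -/
def deviation {V I Ω : Type*} (f : Finset V → ℝ) (alg : OracleAlgorithm V) (r : ℕ)
    (X : Ω → I → ℕ → Finset V → ℝ) (M : Ω → ℕ → Finset I) (ε : ℝ) (j : ℕ) : Set Ω :=
  {ω | ω ∈ deviationOf f X r ε j (serverState alg r (X ω) (M ω) j).action (M ω j)}

theorem mem_deviation {V I Ω : Type*} {f : Finset V → ℝ} {X : Ω → I → ℕ → Finset V → ℝ}
    {M : Ω → ℕ → Finset I} {alg : OracleAlgorithm V} {r : ℕ} {ε : ℝ} {j : ℕ} {ω : Ω} :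
    ω ∈ deviation f alg r X M ε j ↔
      ω ∈ deviationOf f X r ε j (serverState alg r (X ω) (M ω) j).action (M ω j) := by
  rw [deviation, Set.mem_ofPred_eq]

theorem measurableSet_deviationOf {V I Ω : Type*} {_ : MeasurableSpace Ω}
    {X : Ω → I → ℕ → Finset V → ℝ} {r j : ℕ} {A : Finset V}
    (hX : ∀ i, ∀ s < r, Measurable fun ω => X ω i (j * r + s) A) (f : Finset V → ℝ)
    (ε : ℝ) (ν : Finset I) :
    MeasurableSet (deviationOf f X r ε j A ν) :=
  measurableSet_lt measurable_const ((measurable_serverMean hX ν).sub_const (f A)).abs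

/-- Hoeffding's inequality for the answer to the query of a fixed set, when a fixed set of agents
communicates. -/
theorem measureReal_deviationOf_le {V I Ω : Type*} [MeasurableSpace Ω] {μ : Measure Ω}
    [IsProbabilityMeasure μ] {𝕊 : Set (Finset V)} {f : Finset V → ℝ}
    {X : Ω → I → ℕ → Finset V → ℝ} (hX : IsRewardModel μ 𝕊 f X) {A : Finset V}
    (hA : A ∈ 𝕊) {ν : Finset I} (hν : ν.Nonempty) {r : ℕ} (hr : 0 < r) (j : ℕ) {ε : ℝ}
    (hε : 0 ≤ ε) :
    μ.real (deviationOf f X r ε j A ν) ≤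
      2 * Real.exp (-(2 * (ν.card * r) * ε ^ 2)) := by
  set Y : I × ℕ → Ω → ℝ := fun p ω => X ω p.1 (j * r + p.2) A - f A with hY
  have hN : (0 : ℝ) < ν.card * r :=
    mul_pos (by exact_mod_cast hν.card_pos) (by exact_mod_cast hr)
  have hindep : iIndepFun Y μ := by
    have h1 := hX.indep.precomp (g := fun p : I × ℕ => (p.1, j * r + p.2)) (by
      intro p p' h; simp only [Prod.mk.injEq, add_right_inj] at h; exact Prod.ext h.1 h.2)
    exact h1.comp (fun _ w => w ⟨A, hA⟩ - f A) fun _ => by fun_prop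
  have hsub : ∀ p ∈ ν ×ˢ Finset.range r, HasSubgaussianMGF (Y p) (1 / 4) μ := fun p _ => by
    have h := hasSubgaussianMGF_of_mem_Icc (μ := μ)
      (hX.measurable p.1 (j * r + p.2) A hA).aemeasurable
      (.of_forall fun ω => hX.mem_Icc ω p.1 (j * r + p.2) A hA)
    rw [hX.mean A hA] at h
    convert h using 1
    norm_num
  have hsum : ∀ ω, ∑ p ∈ ν ×ˢ Finset.range r, Y p ω =
      ν.card * r * (serverMean (X ω) r j A ν - f A) := fun ω => by
    have : (r : ℝ) ≠ 0 := by positivity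
    have : (ν.card : ℝ) ≠ 0 := by
      have := hν.card_pos
      positivity
    rw [Finset.sum_sub_distrib, Finset.sum_product, serverMean]
    simp only [localMean, ← Finset.sum_div, Finset.sum_const, Finset.card_product,
      Finset.card_range, nsmul_eq_mul]
    push_cast
    field_simp
  have hexp : -(ν.card * r * ε) ^ 2 /
      (2 * (∑ p ∈ ν ×ˢ Finset.range r, (1 / 4 : NNReal) : NNReal)) =
      -(2 * (ν.card * r) * ε ^ 2) := by
    simp only [Finset.sum_const, Finset.card_product, Finset.card_range, nsmul_eq_mul]
    push_cast
    field_simp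
    ring
  have h1 := HasSubgaussianMGF.measure_sum_ge_le_of_iIndepFun hindep hsub
    (mul_nonneg hN.le hε)
  have h2 := HasSubgaussianMGF.measure_sum_ge_le_of_iIndepFun (X := fun p => -Y p)
    (hindep.comp (fun _ x => -x) fun _ => measurable_neg) (fun p hp => (hsub p hp).neg)
    (mul_nonneg hN.le hε)
  rw [hexp] at h1 h2
  have hle : μ.real (deviationOf f X r ε j A ν) ≤
      μ.real ({ω | ν.card * r * ε ≤ ∑ p ∈ ν ×ˢ Finset.range r, Y p ω} ∪
        {ω | ν.card * r * ε ≤ ∑ p ∈ ν ×ˢ Finset.range r, (-Y p) ω}) := by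
    refine measureReal_mono fun ω hω => ?_
    simp only [deviationOf, Set.mem_ofPred_eq, Set.mem_union, Pi.neg_apply, Finset.sum_neg_distrib,
      hsum, ← mul_neg] at hω ⊢
    rcases lt_abs.1 hω with h | h
    · exact Or.inl (mul_le_mul_of_nonneg_left h.le hN.le)
    · exact Or.inr (mul_le_mul_of_nonneg_left h.le hN.le)
  linarith [measureReal_union_le (μ := μ)
    {ω | ν.card * r * ε ≤ ∑ p ∈ ν ×ˢ Finset.range r, Y p ω}
    {ω | ν.card * r * ε ≤ ∑ p ∈ ν ×ˢ Finset.range r, (-Y p) ω}]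

/-! ### The decision made for a block and the rewards in the block -/

section Model

variable {V I Ω : Type*} [Fintype I] {𝕊 : Set (Finset V)} {f : Finset V → ℝ}
  {X : Ω → I → ℕ → Finset V → ℝ} {m : ℕ} {M : Ω → ℕ → Finset I}

/-- The rewards of all agents for the actions in `𝕊` at the times in `S`. -/
def rewards (𝕊 : Set (Finset V)) (X : Ω → I → ℕ → Finset V → ℝ) (S : Finset ℕ) :
    Ω → ((Finset.univ ×ˢ S : Finset (I × ℕ)) → 𝕊 → ℝ) :=
  fun ω p A => X ω p.1.1 p.1.2 A

theorem measurable_rewards_apply {S : Finset ℕ} (i : I) {t : ℕ} (ht : t ∈ S) {A : Finset V}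
    (hA : A ∈ 𝕊) :
    Measurable[MeasurableSpace.comap (rewards 𝕊 X S) inferInstance] fun ω => X ω i t A := by
  have h := (measurable_pi_apply (⟨A, hA⟩ : 𝕊)).comp ((measurable_pi_apply (X := fun _ => 𝕊 → ℝ)
    (⟨(i, t), by simpa using ht⟩ : (Finset.univ ×ˢ S : Finset (I × ℕ)))))
  exact h.comp (comap_measurable (rewards 𝕊 X S))

theorem measurableSet_deviationOf_block {r : ℕ} (j : ℕ) {A : Finset V} (hA : A ∈ 𝕊)
    (ν : Finset I) (f : Finset V → ℝ) (ε : ℝ) :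
    MeasurableSet[MeasurableSpace.comap
      (rewards 𝕊 X (Finset.Ico (j * r) (j * r + r))) inferInstance]
      (deviationOf f X r ε j A ν) :=
  measurableSet_deviationOf
    (fun i s hs => measurable_rewards_apply i (by simp [hs]) hA) f ε ν

variable [MeasurableSpace Ω] {μ : Measure Ω}

theorem IsRewardModel.measurable_rewards (hX : IsRewardModel μ 𝕊 f X) (S : Finset ℕ) :
    Measurable (rewards 𝕊 X S) :=
  measurable_pi_iff.2 fun _ => measurable_pi_iff.2 fun A => hX.measurable _ _ _ A.2

theorem measurableSet_deviation [Finite V] (hX : IsRewardModel μ 𝕊 f X)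
    (hM : IsAgentSelection μ 𝕊 X m M) {alg : OracleAlgorithm V}
    (halg : ∀ k, Measurable fun x : ℕ → ℝ => (alg.run x k).action)
    (hmem : ∀ x k, (alg.run x k).action ∈ 𝕊) (r : ℕ) (ε : ℝ) (j : ℕ) :
    MeasurableSet (deviation f alg r X M ε j) := by
  have hact := measurable_serverState_action halg hmem (X := X) (r := r) hM.measurable j
    fun i t _ A hA => hX.measurable i t A hA
  refine measurableSet_setOfPred.2 (measurable_of_countable_choice (D := Finset V × Finset I)
    (hact.prodMk (hM.measurable j))
    (g := fun d ω => ω ∈ deviationOf f X r ε j d.1 d.2)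
    fun ω => measurableSet_setOfPred.1 (measurableSet_deviationOf
      (fun i s _ => hX.measurable i _ _ ?_) _ _ _))
  rw [serverState_eq_run]
  exact hmem _ _

variable [IsProbabilityMeasure μ]

/-- The selections may depend on each other in any way, so they are taken all together: jointly with
the rewards at the times in `S`, they are independent of the rewards at other times. -/
theorem IsAgentSelection.indepFun_rewards (hX : IsRewardModel μ 𝕊 f X)
    (hM : IsAgentSelection μ 𝕊 X m M) {S S' : Finset ℕ} (hS : Disjoint S S') :
    IndepFun (fun ω => (M ω, rewards 𝕊 X S ω)) (rewards 𝕊 X S') μ := by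
  refine indepFun_prodMk_left (measurable_pi_iff.2 hM.measurable) (hX.measurable_rewards S)
    (hX.measurable_rewards S') ?_ ?_
  · refine hM.indep.comp measurable_id (ψ := fun w : I × ℕ → 𝕊 → ℝ =>
      ((fun p : (Finset.univ ×ˢ S : Finset (I × ℕ)) => w p),
        fun p : (Finset.univ ×ˢ S' : Finset (I × ℕ)) => w p)) (by fun_prop)
  · exact hX.indep.indepFun_finset (Finset.univ ×ˢ S) (Finset.univ ×ˢ S')
      (Finset.disjoint_product.2 (Or.inr hS))
      fun p => measurable_pi_iff.2 fun A => hX.measurable _ _ _ A.2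

/-- The expected value of the functional `g d` of the rewards of block `j`, selected by the action
`A` of that block and the communicating agents `ν`, is that for an independent copy of `(A, ν)`. -/
theorem integral_choice_block [Finite V] (hX : IsRewardModel μ 𝕊 f X)
    (hM : IsAgentSelection μ 𝕊 X m M) {alg : OracleAlgorithm V}
    (halg : ∀ k, Measurable fun x : ℕ → ℝ => (alg.run x k).action)
    (hmem : ∀ x k, (alg.run x k).action ∈ 𝕊) {r : ℕ} (j : ℕ)
    {g : Finset V × Finset I → Ω → ℝ}
    (hg : ∀ A ∈ 𝕊, ∀ ν, Measurable[MeasurableSpace.comap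
      (rewards 𝕊 X (Finset.Ico (j * r) (j * r + r))) inferInstance] (g (A, ν)))
    (hint : ∀ A ∈ 𝕊, ∀ ν, Integrable (g (A, ν)) μ) :
    ∫ ω, g ((serverState alg r (X ω) (M ω) j).action, M ω j) ω ∂μ =
      ∫ ω, (∫ ω', g ((serverState alg r (X ω) (M ω) j).action, M ω j) ω' ∂μ) ∂μ := by
  have hdisj : Disjoint (Finset.range (j * r)) (Finset.Ico (j * r) (j * r + r)) := by
    rw [Finset.range_eq_Ico]; exact Finset.Ico_disjoint_Ico_consecutive _ _ _
  have hind := (hM.indepFun_rewards hX hdisj)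
  rw [IndepFun_iff_Indep] at hind
  have hmem' : ∀ ω, (serverState alg r (X ω) (M ω) j).action ∈ 𝕊 := fun ω => by
    rw [serverState_eq_run]; exact hmem _ _
  refine integral_choice ?_ hind
    (d := fun ω => ((serverState alg r (X ω) (M ω) j).action, M ω j)) ?_
    (fun ω => hg _ (hmem' ω) _) (fun ω => hint _ (hmem' ω) _)
  · exact ((measurable_pi_iff.2 hM.measurable).prodMk (hX.measurable_rewards _)).comap_le
  · have hZ := comap_measurable (m := Prod.instMeasurableSpace)
      (fun ω => (M ω, rewards 𝕊 X (Finset.range (j * r)) ω))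
    have hM' := fun i => (measurable_pi_apply i).comp (measurable_fst.comp hZ)
    refine Measurable.prodMk ?_ (hM' j)
    refine @measurable_serverState_action V I Ω (MeasurableSpace.comap
      (fun ω => (M ω, rewards 𝕊 X (Finset.range (j * r)) ω)) inferInstance) _ _ 𝕊 alg halg hmem
      X M r hM' j fun i t ht A hA => ?_
    exact (measurable_rewards_apply i (Finset.mem_range.2 ht) hA).mono
      (measurable_snd.comp hZ).comap_le le_rfl

/-- The bound for fixed queries carries over to the adaptive query of block `j` without loss, since
the query and the selected agents are independent of the rewards in the block. -/
theorem measureReal_deviation_le [Finite V] (hX : IsRewardModel μ 𝕊 f X)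
    (hM : IsAgentSelection μ 𝕊 X m M) (hm : 0 < m) {alg : OracleAlgorithm V}
    (halg : ∀ k, Measurable fun x : ℕ → ℝ => (alg.run x k).action)
    (hmem : ∀ x k, (alg.run x k).action ∈ 𝕊) {r : ℕ} (hr : 0 < r) {ε : ℝ} (hε : 0 ≤ ε) (j : ℕ) :
    μ.real (deviation f alg r X M ε j) ≤ 2 * Real.exp (-(2 * (m * r) * ε ^ 2)) := by
  have hmem' : ∀ ω, (serverState alg r (X ω) (M ω) j).action ∈ 𝕊 := fun ω => by
    rw [serverState_eq_run]; exact hmem _ _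
  have hset : ∀ A ∈ 𝕊, ∀ ν, MeasurableSet (deviationOf f X r ε j A ν) :=
    fun A hA ν => (hX.measurable_rewards _).comap_le _
      (measurableSet_deviationOf_block (r := r) j hA ν f ε)
  have h := integral_choice_block hX hM halg hmem (r := r) j
    (g := fun d => (deviationOf f X r ε j d.1 d.2).indicator fun _ => 1)
    (fun A hA ν => Measurable.indicator measurable_const
        (measurableSet_deviationOf_block j hA ν f ε))
    (fun A hA ν => (integrable_const (1 : ℝ)).indicator (hset A hA ν))
  have hl : ∀ ω, (deviationOf f X r ε j (serverState alg r (X ω) (M ω) j).action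
      (M ω j)).indicator (fun _ => (1 : ℝ)) ω =
      (deviation f alg r X M ε j).indicator (fun _ => 1) ω := fun ω => by
    by_cases hω : ω ∈ deviation f alg r X M ε j
    · rw [Set.indicator_of_mem hω, Set.indicator_of_mem (mem_deviation.1 hω)]
    · rw [Set.indicator_of_notMem hω, Set.indicator_of_notMem (mt mem_deviation.2 hω)]
  simp only [hl, integral_indicator_const _ (hset _ (hmem' _) _)] at h
  rw [integral_indicator_const _ (measurableSet_deviation hX hM halg hmem r ε j), smul_eq_mul,
    mul_one] at h
  rw [h]
  have hle : ∀ ω, ‖μ.real (deviationOf f X r ε j (serverState alg r (X ω) (M ω) j).action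
      (M ω j)) • (1 : ℝ)‖ ≤ 2 * Real.exp (-(2 * (m * r) * ε ^ 2)) := fun ω => by
    rw [smul_eq_mul, mul_one, Real.norm_of_nonneg measureReal_nonneg]
    have h3 := measureReal_deviationOf_le hX (hmem' ω) (ν := M ω j)
      (Finset.card_pos.1 (by rw [hM.card_eq]; exact hm)) hr j hε
    rwa [hM.card_eq] at h3
  have h4 := norm_integral_le_of_norm_le_const (μ := μ) (Filter.Eventually.of_forall hle)
  rw [probReal_univ, mul_one] at h4
  exact (Real.le_norm_self _).trans h4

end Model

/-! ### From resilience to regret -/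

theorem communicationRounds_finite {V I : Type*} {acc : Finset V → ℝ → Prop}
    {Q P : Finset V → Prop} {N : ℕ} {alg : OracleAlgorithm V} (h : Ensures acc Q P N alg)
    (hacc : ∀ A x, acc A x) (r : ℕ) (x : I → ℕ → Finset V → ℝ) (M : ℕ → Finset I) :
    (communicationRounds alg r x M).Finite ∧ (communicationRounds alg r x M).ncard ≤ N := by
  have hsub : communicationRounds alg r x M ⊆ Finset.range N := fun j hj => by
    by_contra hlt
    obtain ⟨Θ, hΘ, -⟩ := h.run_eq_output
      (x := fun j => serverMean x r j (serverState alg r x M j).action (M j))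
      (fun _ _ => hacc _ _) (not_lt.1 (by simpa using hlt))
    rw [communicationRounds, Set.mem_ofPred_eq, serverState_eq_run, hΘ] at hj
    exact hj
  refine ⟨(Finset.finite_toSet _).subset hsub, ?_⟩
  simpa using Set.ncard_le_ncard hsub (Finset.finite_toSet _)

section Model

variable {V I Ω : Type*} [Fintype V] [Fintype I] [MeasurableSpace Ω] {μ : Measure Ω}
  [IsProbabilityMeasure μ] {𝕊 : Set (Finset V)} {f : Finset V → ℝ}
  {X : Ω → I → ℕ → Finset V → ℝ} {m : ℕ} {M : Ω → ℕ → Finset I}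

theorem IsRewardModel.mem_Icc_mean {V I Ω : Type*} [MeasurableSpace Ω] {μ : Measure Ω}
    [IsProbabilityMeasure μ] {𝕊 : Set (Finset V)} {f : Finset V → ℝ}
    {X : Ω → I → ℕ → Finset V → ℝ} (hX : IsRewardModel μ 𝕊 f X) (i : I) {A : Finset V}
    (hA : A ∈ 𝕊) : f A ∈ Set.Icc (0 : ℝ) 1 := by
  rw [← hX.mean A hA i 0]
  have hb := fun ω => hX.mem_Icc ω i 0 A hA
  have hint : Integrable (fun ω => X ω i 0 A) μ :=
    .of_mem_Icc 0 1 (hX.measurable i 0 A hA).aemeasurable (.of_forall hb)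
  refine ⟨integral_nonneg fun ω => (hb ω).1, ?_⟩
  have := integral_mono hint (integrable_const 1) fun ω => (hb ω).2
  simpa using this

/-- A played action is independent of the rewards at the time it is played, so the expected reward
is the expected value of the action. -/
theorem integral_reward_playedAction (hX : IsRewardModel μ 𝕊 f X)
    (hM : IsAgentSelection μ 𝕊 X m M) {alg : OracleAlgorithm V}
    (halg : ∀ k, Measurable fun x : ℕ → ℝ => (alg.run x k).action)
    (hmem : ∀ x k, (alg.run x k).action ∈ 𝕊) {r : ℕ} (hr : 0 < r) (i : I) (t : ℕ) :
    Integrable (fun ω => X ω i t (playedAction alg r (X ω) (M ω) t)) μ ∧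
      Integrable (fun ω => f (playedAction alg r (X ω) (M ω) t)) μ ∧
      ∫ ω, X ω i t (playedAction alg r (X ω) (M ω) t) ∂μ =
        ∫ ω, f (playedAction alg r (X ω) (M ω) t) ∂μ := by
  have hmem' : ∀ ω, playedAction alg r (X ω) (M ω) t ∈ 𝕊 := fun ω => by
    rw [playedAction, serverState_eq_run]; exact hmem _ _
  have hact : Measurable fun ω => playedAction alg r (X ω) (M ω) t :=
    measurable_serverState_action halg hmem hM.measurable _ fun i t _ A hA => hX.measurable i t A hA
  have hint : ∀ A ∈ 𝕊, Integrable (fun ω => X ω i t A) μ := fun A hA =>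
    .of_mem_Icc 0 1 (hX.measurable i t A hA).aemeasurable
      (.of_forall fun ω => hX.mem_Icc ω i t A hA)
  refine ⟨.of_mem_Icc 0 1 (measurable_of_countable_choice hact (g := fun A ω => X ω i t A)
      fun ω => hX.measurable i t _ (hmem' ω)).aemeasurable
      (.of_forall fun ω => hX.mem_Icc ω i t _ (hmem' ω)),
    .of_mem_Icc 0 1 (measurable_of_countable_choice hact (g := fun A _ => f A)
      fun ω => measurable_const).aemeasurable
      (.of_forall fun ω => hX.mem_Icc_mean i (hmem' ω)), ?_⟩
  have hdiv := Nat.div_add_mod t r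
  have hmod := Nat.mod_lt t hr
  rw [mul_comm] at hdiv
  have h := integral_choice_block hX hM halg hmem (r := r) (t / r) (g := fun d ω => X ω i t d.1)
    (fun A hA _ => measurable_rewards_apply i (Finset.mem_Ico.2 ⟨by omega, by omega⟩) hA)
    fun A hA _ => hint A hA
  refine h.trans (integral_congr_ae (.of_forall fun ω => ?_))
  exact hX.mean _ (hmem' ω) i t

/-- If an offline algorithm makes at most `N` queries and outputs an `α`-approximation up to `Δ`
whenever its answers are correct up to `ε`, then the expected `α`-regret is at most the length
`N r` of the exploration, plus `T` times `Δ` and the probability that some answer is off by more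
than `ε`. -/
theorem integral_regret_le (hX : IsRewardModel μ 𝕊 f X)
    (hM : IsAgentSelection μ 𝕊 X m M) (hm : 0 < m) {alg : OracleAlgorithm V}
    (halg : ∀ k, Measurable fun x : ℕ → ℝ => (alg.run x k).action)
    (hmem : ∀ x k, (alg.run x k).action ∈ 𝕊) {r : ℕ} (hr : 0 < r) {α ε Δ : ℝ} (hα : α ≤ 1)
    (hε : 0 ≤ ε) (hΔ : 0 ≤ Δ) {N : ℕ} {Q : Finset V → Prop} {Sopt : Finset V}
    (hSopt : Sopt ∈ 𝕊)
    (happrox : Ensures (fun A x => |x - f A| ≤ ε) Q (fun Θ => α * f Sopt - Δ ≤ f Θ) N alg)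
    (i : I) (T : ℕ) :
    Integrable (fun ω => regret α alg r (X ω) (M ω) Sopt i T) μ ∧
      ∫ ω, regret α alg r (X ω) (M ω) Sopt i T ∂μ ≤
        N * r + T * (Δ + N * (2 * Real.exp (-(2 * (m * r) * ε ^ 2)))) := by
  have hplay := integral_reward_playedAction hX hM halg hmem hr i
  have hmem' : ∀ ω t, playedAction alg r (X ω) (M ω) t ∈ 𝕊 := fun ω t => by
    rw [playedAction, serverState_eq_run]; exact hmem _ _
  have hopt : ∀ t, Integrable (fun ω => X ω i t Sopt) μ := fun t =>
    .of_mem_Icc 0 1 (hX.measurable i t Sopt hSopt).aemeasurable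
      (.of_forall fun ω => hX.mem_Icc ω i t Sopt hSopt)
  have hterm : ∀ t, Integrable
      (fun ω => α * X ω i t Sopt - X ω i t (playedAction alg r (X ω) (M ω) t)) μ := fun t =>
    ((hopt t).const_mul α).sub (hplay t).1
  refine ⟨integrable_finsetSum _ fun t _ => hterm t, ?_⟩
  set bad : Set Ω := ⋃ j ∈ Finset.range N, deviation f alg r X M ε j with hbad
  set p : ℝ := N * (2 * Real.exp (-(2 * (m * r) * ε ^ 2))) with hp
  have hbadm : MeasurableSet bad := Finset.measurableSet_biUnion _ fun j _ =>
    measurableSet_deviation hX hM halg hmem r ε j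
  have hbadp : μ.real bad ≤ p := by
    refine (measureReal_biUnion_finset_le _ _).trans ((Finset.sum_le_sum fun j _ =>
      measureReal_deviation_le hX hM hm halg hmem hr hε j).trans_eq ?_)
    simp [hp]
  have hSopt01 := hX.mem_Icc_mean i hSopt
  have hαS : α * f Sopt ≤ 1 := mul_le_one₀ hα hSopt01.1 hSopt01.2
  -- After the exploration the output is played, which is good outside the event `bad`.
  have hexploit : ∀ t, N * r ≤ t → ∀ ω,
      α * f Sopt - f (playedAction alg r (X ω) (M ω) t) ≤ Δ + bad.indicator (fun _ => 1) ω := by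
    intro t ht ω
    by_cases hω : ω ∈ bad
    · rw [Set.indicator_of_mem hω]
      linarith [(hX.mem_Icc_mean i (hmem' ω t)).1]
    · rw [Set.indicator_of_notMem hω]
      have hgood : ∀ j < N, |serverMean (X ω) r j (serverState alg r (X ω) (M ω) j).action
          (M ω j) - f (serverState alg r (X ω) (M ω) j).action| ≤ ε := fun j hj => by
        have h1 : ω ∉ deviation f alg r X M ε j := fun h =>
          hω (Set.mem_biUnion (Finset.mem_coe.2 (Finset.mem_range.2 hj)) h)
        rw [mem_deviation, deviationOf, Set.mem_ofPred_eq] at h1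
        exact not_lt.1 h1
      obtain ⟨Θ, hΘ, hΘ'⟩ := happrox.run_eq_output
        (x := fun j => serverMean (X ω) r j (serverState alg r (X ω) (M ω) j).action (M ω j))
        (fun j hj => by rw [← serverState_eq_run]; exact hgood j hj)
        ((Nat.le_div_iff_mul_le hr).2 ht)
      rw [playedAction, serverState_eq_run, hΘ, action]
      linarith
  have hmean : ∀ t, ∫ ω, (α * X ω i t Sopt - X ω i t (playedAction alg r (X ω) (M ω) t)) ∂μ =
      ∫ ω, (α * f Sopt - f (playedAction alg r (X ω) (M ω) t)) ∂μ := fun t => by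
    rw [integral_sub ((hopt t).const_mul α) (hplay t).1, integral_const_mul,
      hX.mean Sopt hSopt, (hplay t).2.2, integral_sub (integrable_const _) (hplay t).2.1]
    simp
  have hbound : ∀ t, ∫ ω, (α * X ω i t Sopt - X ω i t (playedAction alg r (X ω) (M ω) t)) ∂μ ≤
      (if t < N * r then 1 else 0) + (Δ + p) := fun t => by
    rw [hmean]
    have hi : Integrable (fun ω => α * f Sopt - f (playedAction alg r (X ω) (M ω) t)) μ :=
      (integrable_const _).sub (hplay t).2.1
    have hp0 : 0 ≤ p := measureReal_nonneg.trans hbadp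
    split_ifs with ht
    · have := integral_mono hi (integrable_const 1) fun ω => by
        show α * f Sopt - f (playedAction alg r (X ω) (M ω) t) ≤ 1
        linarith [(hX.mem_Icc_mean i (hmem' ω t)).1]
      rw [integral_const, probReal_univ, one_smul] at this
      linarith
    · have hind : Integrable (bad.indicator fun _ => (1 : ℝ)) μ :=
        (integrable_const 1).indicator hbadm
      have := integral_mono hi ((integrable_const Δ).add hind) fun ω =>
        hexploit t (not_lt.1 ht) ω
      rw [integral_add' (integrable_const Δ) hind, integral_const, probReal_univ, one_smul,
        integral_indicator_const _ hbadm, smul_eq_mul, mul_one] at this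
      linarith
  unfold regret
  rw [integral_finsetSum _ fun t _ => hterm t]
  refine (Finset.sum_le_sum fun t _ => hbound t).trans ?_
  rw [Finset.sum_add_distrib, Finset.sum_const, Finset.card_range, nsmul_eq_mul, Finset.sum_boole]
  gcongr
  have hsub : (Finset.range T).filter (fun t => t < N * r) ⊆ Finset.range (N * r) := fun t ht =>
    Finset.mem_range.2 (Finset.mem_filter.1 ht).2
  have := Finset.card_le_card hsub
  rw [Finset.card_range] at this
  exact_mod_cast this

end Model

/-! ### The size of feasible sets and the choice of the exploration length -/

section Size

variable {V : Type*} [Finite V] {c : V → ℝ} {B : ℝ}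

theorem iInf_cost_le (c : V → ℝ) (v : V) : ⨅ v, c v ≤ c v :=
  ciInf_le (Set.finite_range c).bddBelow v

variable [Nonempty V]

theorem iInf_cost_pos (hc : ∀ v, 0 < c v) : 0 < ⨅ v, c v := by
  obtain ⟨v, hv⟩ := exists_eq_ciInf_of_finite (f := c)
  exact hv ▸ hc v

theorem one_le_budgetRatio (hc : ∀ v, 0 < c v ∧ c v ≤ B) : 1 ≤ budgetRatio c B := by
  obtain ⟨v⟩ := ‹Nonempty V›
  rw [budgetRatio, one_le_div (iInf_cost_pos fun v => (hc v).1)]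
  exact (iInf_cost_le c v).trans (hc v).2

theorem card_le_budgetRatio (hc : ∀ v, 0 < c v) {A : Finset V} (hA : A ∈ knapsack c B) :
    (A.card : ℝ) ≤ budgetRatio c B := by
  rw [budgetRatio, le_div_iff₀ (iInf_cost_pos hc), ← nsmul_eq_mul]
  exact (Finset.card_nsmul_le_sum A c _ fun v _ => iInf_cost_le c v).trans hA

end Size

/-- The balance between exploration and exploitation. The letters stand for the cube roots of
`m`, `q`, `δ`, `K̃`, `n`, `T` and `√(log T)`; `R` is the exploration length, `N` the number of
blocks, `l ^ 3 / z` the accuracy of the answers, and `2 P` bounds the probability of a deviation in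
a single block. -/
theorem exploration_balance {a b d k ν τ l z N R P : ℝ} (ha : 1 ≤ a) (hb : 1 ≤ b) (hk : 1 ≤ k)
    (hν : 1 ≤ ν) (hτ : 1 ≤ τ) (hl : 0 < l) (hbd : b ≤ d) (hd : d ≤ 2 * b) (hT : ν * k * a ≤ τ)
    (hl2 : 1 ≤ 2 * l ^ 6) (hz : z = d * l * τ * a / (ν * k))
    (hN : N ≤ 2 * (ν ^ 3 * k ^ 3)) (hR : R ≤ z ^ 2 / a ^ 3 + 1) (hR0 : 0 ≤ R)
    (hP0 : 0 ≤ P) (hP : P ≤ 1 / τ ^ 6) :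
    N * R + τ ^ 3 * ((2 * b ^ 3 + 2) * (l ^ 3 / z) + N * (2 * P)) ≤
      36 * (a⁻¹ * b ^ 2 * k ^ 3 * ν * τ ^ 2) * l ^ 6 := by
  have hd0 : 0 < d := by linarith
  have hl4 : l ^ 2 ≤ 2 * l ^ 6 := by
    have h1 : 1 ≤ 2 * l ^ 4 := by
      by_contra hcon
      have h2 : l ^ 4 < 1 / 2 := by linarith
      have h3 : l ^ 2 ≤ 1 := by
        by_contra h4
        nlinarith
      have h4 : l ^ 6 = l ^ 4 * l ^ 2 := by ring
      nlinarith [pow_pos hl 4]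
    have : l ^ 6 = l ^ 4 * l ^ 2 := by ring
    nlinarith [pow_pos hl 2]
  set E := a⁻¹ * b ^ 2 * k ^ 3 * ν * τ ^ 2 with hE
  -- The common order of the exploration and of the exploitation error.
  set F := a⁻¹ * b ^ 2 * k * ν * τ ^ 2 * l ^ 2 with hF
  have hkk : k ≤ k ^ 3 := le_self_pow₀ hk (by norm_num)
  have hFE : F ≤ 2 * (E * l ^ 6) := by
    calc F = a⁻¹ * b ^ 2 * ν * τ ^ 2 * (k * l ^ 2) := by rw [hF]; ring
      _ ≤ a⁻¹ * b ^ 2 * ν * τ ^ 2 * (k ^ 3 * (2 * l ^ 6)) := by gcongr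
      _ = 2 * (E * l ^ 6) := by rw [hE]; ring
  have hψE : ν ^ 3 * k ^ 3 ≤ 2 * (E * l ^ 6) := by
    have h1 : (ν * k) ^ 2 ≤ a⁻¹ * τ ^ 2 := by
      rw [inv_mul_eq_div, le_div_iff₀ (by positivity)]
      calc (ν * k) ^ 2 * a ≤ (ν * k) ^ 2 * a ^ 2 := by
            gcongr; exact le_self_pow₀ ha (by norm_num)
        _ = (ν * k * a) ^ 2 := by ring
        _ ≤ τ ^ 2 := by gcongr
    calc ν ^ 3 * k ^ 3 = 1 * (ν * k * (ν * k) ^ 2) * 1 := by ring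
      _ ≤ b ^ 2 * (ν * k ^ 3 * (a⁻¹ * τ ^ 2)) * (2 * l ^ 6) := by
          gcongr
          exact one_le_pow₀ hb
      _ = 2 * (E * l ^ 6) := by rw [hE]; ring
  have h1 : N * R ≤ 8 * F + 2 * (ν ^ 3 * k ^ 3) := by
    calc N * R ≤ 2 * (ν ^ 3 * k ^ 3) * (z ^ 2 / a ^ 3 + 1) := by gcongr
      _ = 2 * (a⁻¹ * d ^ 2 * k * ν * τ ^ 2 * l ^ 2) + 2 * (ν ^ 3 * k ^ 3) := by
          rw [hz]; field_simp
      _ ≤ 2 * (a⁻¹ * (2 * b) ^ 2 * k * ν * τ ^ 2 * l ^ 2) + 2 * (ν ^ 3 * k ^ 3) := by gcongr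
      _ = 8 * F + 2 * (ν ^ 3 * k ^ 3) := by rw [hF]; ring
  have h2 : τ ^ 3 * ((2 * b ^ 3 + 2) * (l ^ 3 / z)) ≤ 4 * F := by
    have hb3 : 1 ≤ b ^ 3 := one_le_pow₀ hb
    have hzz : l ^ 3 / z ≤ l ^ 2 * (ν * k) / (b * τ * a) := by
      rw [hz]
      calc l ^ 3 / (d * l * τ * a / (ν * k)) = l ^ 2 * (ν * k) / (d * τ * a) := by field_simp
        _ ≤ l ^ 2 * (ν * k) / (b * τ * a) := by gcongr
    calc τ ^ 3 * ((2 * b ^ 3 + 2) * (l ^ 3 / z))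
        ≤ τ ^ 3 * ((4 * b ^ 3) * (l ^ 2 * (ν * k) / (b * τ * a))) := by
          gcongr
          · rw [hz]; positivity
          · linarith
      _ = 4 * F := by rw [hF]; field_simp
  have h3 : τ ^ 3 * (N * (2 * P)) ≤ 4 * (ν ^ 3 * k ^ 3) := by
    have hτP : τ ^ 3 * P ≤ 1 := by
      calc τ ^ 3 * P ≤ τ ^ 3 * (1 / τ ^ 6) := by gcongr
        _ = 1 / τ ^ 3 := by field_simp
        _ ≤ 1 := by rw [div_le_one (by positivity)]; exact one_le_pow₀ hτ
    have hPτ0 : 0 ≤ τ ^ 3 * P := by positivity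
    calc τ ^ 3 * (N * (2 * P)) = 2 * (N * (τ ^ 3 * P)) := by ring
      _ ≤ 2 * (2 * (ν ^ 3 * k ^ 3) * 1) := by gcongr
      _ = 4 * (ν ^ 3 * k ^ 3) := by ring
  calc _ = N * R + (τ ^ 3 * ((2 * b ^ 3 + 2) * (l ^ 3 / z)) + τ ^ 3 * (N * (2 * P))) := by ring
    _ ≤ (8 * F + 2 * (ν ^ 3 * k ^ 3)) + (4 * F + 4 * (ν ^ 3 * k ^ 3)) := by gcongr
    _ ≤ 36 * E * l ^ 6 := by linarith

theorem rpow_third_pow {x : ℝ} (hx : 0 ≤ x) : (x ^ (1 / 3 : ℝ)) ^ 3 = x := by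
  rw [← Real.rpow_natCast, ← Real.rpow_mul hx]; norm_num

theorem rpow_two_thirds {x : ℝ} (hx : 0 ≤ x) : x ^ (2 / 3 : ℝ) = (x ^ (1 / 3 : ℝ)) ^ 2 := by
  rw [← Real.rpow_natCast, ← Real.rpow_mul hx]; norm_num

/-- For `β = 0` the exploration length is, up to rounding, `z ^ 2 / m` with
`z ^ 3 = δ √(log T) T m / ψ`. -/
theorem explorationLength_bounds {T m : ℕ} {ψ δ z : ℝ} (hm : 0 < m) (hz : 0 < z)
    (h : z ^ 3 = δ * √(Real.log T) * (T * m / ψ)) :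
    z ^ 2 ≤ m * explorationLength T m 0 ψ δ ∧
      (explorationLength T m 0 ψ δ : ℝ) ≤ z ^ 2 / m + 1 := by
  have hm' : (0 : ℝ) < m := by exact_mod_cast hm
  have hval : (m : ℝ)⁻¹ * (δ * √(Real.log T) * (T * m / ψ) ^ (1 / ((0 : ℝ) + 1))) ^
      ((2 + 2 * (0 : ℝ)) / (3 + 0)) = z ^ 2 / m := by
    have h1 : (1 : ℝ) / (0 + 1) = 1 := by norm_num
    have h2 : (2 + 2 * (0 : ℝ)) / (3 + 0) = 2 / 3 := by norm_num
    rw [h1, h2, Real.rpow_one, ← h, ← Real.rpow_natCast z 3, ← Real.rpow_mul hz.le,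
      inv_mul_eq_div, ← Real.rpow_natCast z 2]
    norm_num
  rw [explorationLength, hval]
  refine ⟨?_, (Nat.ceil_lt_add_one (by positivity)).le⟩
  have := Nat.le_ceil (z ^ 2 / m)
  rw [div_le_iff₀ hm'] at this
  linarith

end CMAMAB

theorem mainTheorem9 :
    ∃ (C : ℝ) (κ : ℕ), ∀ (n m' m T : ℕ) (c : Fin n → ℝ) (B : ℝ) (tie : Finset (Fin n) → Fin n)
      (f : Finset (Fin n) → ℝ)
      (Ω : Type*) (_ : MeasurableSpace Ω) (μ : Measure Ω) (_ : IsProbabilityMeasure μ)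
      (X : Ω → Fin m' → ℕ → Finset (Fin n) → ℝ) (M : Ω → ℕ → Finset (Fin m'))
      (Sopt : Finset (Fin n)),
      1 ≤ n → 1 ≤ m → m ≤ m' → 2 ≤ T →
      n * sizeBound c B * m ≤ T →
      (∀ v, 0 < c v ∧ c v ≤ B) →
      (∀ s : Finset (Fin n), s.Nonempty → tie s ∈ s) →
      Monotone f → IsSubmodular f →
      IsRewardModel μ (knapsack c B) f X →
      IsAgentSelection μ (knapsack c B) X m M →
      Sopt ∈ knapsack c B → (∀ A ∈ knapsack c B, f A ≤ f Sopt) →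
      (∀ ω,
        (communicationRounds (greedyMax c B tie) (greedyMaxExplorationLength c B T m)
          (X ω) (M ω)).Finite ∧
        ((communicationRounds (greedyMax c B tie) (greedyMaxExplorationLength c B T m)
          (X ω) (M ω)).ncard : ℝ) ≤ C * (n * sizeBound c B)) ∧
      (∀ i : Fin m',
        Integrable (fun ω => regret (1 / 2) (greedyMax c B tie)
          (greedyMaxExplorationLength c B T m) (X ω) (M ω) Sopt i T) μ ∧
        ∫ ω, regret (1 / 2) (greedyMax c B tie)
          (greedyMaxExplorationLength c B T m) (X ω) (M ω) Sopt i T ∂μ ≤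
            C * ((m : ℝ) ^ (-(1 / 3) : ℝ) * budgetRatio c B ^ (2 / 3 : ℝ) * sizeBound c B *
              (n : ℝ) ^ (1 / 3 : ℝ) * (T : ℝ) ^ (2 / 3 : ℝ)) * Real.log T ^ κ) := by
  refine ⟨36, 1, ?_⟩
  intro n m' m T c B tie f Ω _ μ _ X M Sopt hn hm _ hT hTψ hc htie hmono hsub hX hM hSopt _
  have : Nonempty (Fin n) := ⟨⟨0, hn⟩⟩
  have hc0 : ∀ v, 0 < c v := fun v => (hc v).1
  have hB : 0 ≤ B := ((hc ⟨0, hn⟩).1.le).trans (hc ⟨0, hn⟩).2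
  set q := budgetRatio c B with hq
  set K := sizeBound c B with hK
  have hq1 : 1 ≤ q := one_le_budgetRatio hc
  have hn1 : (1 : ℝ) ≤ n := by exact_mod_cast hn
  have hm1 : (1 : ℝ) ≤ m := by exact_mod_cast hm
  have hT2 : (2 : ℝ) ≤ T := by exact_mod_cast hT
  have hKdef : K = min (n : ℝ) q := by rw [hK, sizeBound, Fintype.card_fin]
  have hK1 : 1 ≤ K := hKdef ▸ le_min hn1 hq1
  have hKq : K ≤ q := hKdef ▸ min_le_right _ _
  have hcard : ∀ A ∈ knapsack c B, A.card ≤ ⌊K⌋₊ := fun A hA => Nat.le_floor <| hKdef ▸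
    le_min (by exact_mod_cast (Finset.card_le_univ A).trans_eq (Fintype.card_fin n))
      (card_le_budgetRatio hc0 hA)
  have hN : ((Fintype.card (Fin n) * ⌊K⌋₊ + 1 : ℕ) : ℝ) ≤ 2 * (n * K) := by
    rw [Fintype.card_fin]
    push_cast
    have h1 := Nat.floor_le (zero_le_one.trans hK1)
    have h2 : (n : ℝ) * ⌊K⌋₊ ≤ n * K := by gcongr
    have h3 : 1 ≤ (n : ℝ) * K := one_le_mul_of_one_le_of_one_le hn1 hK1
    linarith
  have hfeas := ensures_feasible_greedyMax hB hc htie hcard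
  refine ⟨fun ω => ?_, fun i => ?_⟩
  · obtain ⟨hfin, hle⟩ := communicationRounds_finite hfeas (fun _ _ => trivial)
      (greedyMaxExplorationLength c B T m) (X ω) (M ω)
    refine ⟨hfin, ?_⟩
    have h1 : ((communicationRounds (greedyMax c B tie) (greedyMaxExplorationLength c B T m)
      (X ω) (M ω)).ncard : ℝ) ≤ 2 * (n * K) := le_trans (by exact_mod_cast hle) hN
    have h2 : 0 ≤ (n : ℝ) * K := by positivity
    linarith
  · have hL0 : 1 / 2 ≤ Real.log T := by
      have := Real.log_le_log (by norm_num) hT2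
      linarith [Real.log_two_gt_d9]
    have hLpos : 0 < Real.log T := by linarith
    set δ := 1 / 2 + K + 2 * q with hδ
    have third_pos : ∀ {x : ℝ}, 1 ≤ x → 1 ≤ x ^ (1 / 3 : ℝ) := fun hx =>
      Real.one_le_rpow hx (by norm_num)
    have third_mono : ∀ {x y : ℝ}, 0 ≤ x → 0 ≤ y → x ≤ y ^ 3 → x ^ (1 / 3 : ℝ) ≤ y :=
      fun {x y} hx hy hxy => by
        refine le_of_pow_le_pow_left₀ (n := 3) (by norm_num) hy ?_
        rwa [rpow_third_pow hx]
    -- Cube roots of all parameters turn the powers in the bound into monomials.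
    obtain ⟨a, ha⟩ : ∃ a, a = (m : ℝ) ^ (1 / 3 : ℝ) := ⟨_, rfl⟩
    obtain ⟨b, hb⟩ : ∃ b, b = q ^ (1 / 3 : ℝ) := ⟨_, rfl⟩
    obtain ⟨d, hd⟩ : ∃ d, d = δ ^ (1 / 3 : ℝ) := ⟨_, rfl⟩
    obtain ⟨k, hk⟩ : ∃ k, k = K ^ (1 / 3 : ℝ) := ⟨_, rfl⟩
    obtain ⟨ν, hν⟩ : ∃ ν, ν = (n : ℝ) ^ (1 / 3 : ℝ) := ⟨_, rfl⟩
    obtain ⟨τ, hτ⟩ : ∃ τ, τ = (T : ℝ) ^ (1 / 3 : ℝ) := ⟨_, rfl⟩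
    obtain ⟨l, hl⟩ : ∃ l, l = (√(Real.log T)) ^ (1 / 3 : ℝ) := ⟨_, rfl⟩
    have ha3 : a ^ 3 = m := by rw [ha, rpow_third_pow (by positivity)]
    have hb3 : b ^ 3 = q := by rw [hb, rpow_third_pow (by positivity)]
    have hd3 : d ^ 3 = δ := by rw [hd, rpow_third_pow (by positivity)]
    have hk3 : k ^ 3 = K := by rw [hk, rpow_third_pow (by positivity)]
    have hν3 : ν ^ 3 = n := by rw [hν, rpow_third_pow (by positivity)]
    have hτ3 : τ ^ 3 = T := by rw [hτ, rpow_third_pow (by positivity)]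
    have hl3 : l ^ 3 = √(Real.log T) := by rw [hl, rpow_third_pow (by positivity)]
    have hl6 : l ^ 6 = Real.log T := by
      calc l ^ 6 = (l ^ 3) ^ 2 := by ring
        _ = Real.log T := by rw [hl3, Real.sq_sqrt hLpos.le]
    have ha1 : 1 ≤ a := ha ▸ third_pos hm1
    have hb1 : 1 ≤ b := hb ▸ third_pos hq1
    have hk1 : 1 ≤ k := hk ▸ third_pos hK1
    have hν1 : 1 ≤ ν := hν ▸ third_pos hn1
    have hτ1 : 1 ≤ τ := hτ ▸ third_pos (by linarith)
    have hl0 : 0 < l := hl ▸ Real.rpow_pos_of_pos (Real.sqrt_pos.2 hLpos) _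
    have hd0 : 0 ≤ d := hd ▸ by positivity
    have hbd : b ≤ d := hb ▸ third_mono (by positivity) hd0 (by rw [hd3, hδ]; linarith)
    have hd2 : d ≤ 2 * b := hd ▸ third_mono (by positivity) (by positivity) (by
      rw [mul_pow, hb3, hδ]; linarith)
    have hτψ : ν * k * a ≤ τ := by
      refine le_of_pow_le_pow_left₀ (n := 3) (by norm_num) (by positivity) ?_
      rwa [mul_pow, mul_pow, hν3, hk3, ha3, hτ3]
    obtain ⟨z, hz⟩ : ∃ z, z = d * l * τ * a / (ν * k) := ⟨_, rfl⟩
    have hd0' : 0 < d := by linarith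
    have hz0 : 0 < z := hz ▸ by positivity
    obtain ⟨hr1, hr2⟩ := explorationLength_bounds (T := T) (m := m) (ψ := n * K) (δ := δ) hm hz0
      (by rw [hz, div_pow, mul_pow, mul_pow, mul_pow, mul_pow, hd3, hl3, hτ3, ha3, hν3, hk3]; ring)
    have hrdef : greedyMaxExplorationLength c B T m = explorationLength T m 0 (n * K) δ := by
      rw [greedyMaxExplorationLength, Fintype.card_fin]
    rw [← hrdef] at hr1 hr2
    obtain ⟨r, hr⟩ : ∃ r, r = greedyMaxExplorationLength c B T m := ⟨_, rfl⟩
    rw [← hr] at hr1 hr2 ⊢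
    have hr0 : 0 < r := by
      rcases Nat.eq_zero_or_pos r with h | h
      · rw [h, Nat.cast_zero, mul_zero] at hr1
        exact absurd hr1 (not_le.2 (by positivity))
      · exact h
    have hε : 0 ≤ l ^ 3 / z := by positivity
    have happrox := ensures_approx_greedyMax hc htie hcard
      (fun A hA => card_le_budgetRatio hc0 hA) hmono hsub
      (hX.mem_Icc_mean i (by simpa [knapsack, setCost] using hB)).1 hSopt hε
    simp only [div_eq_inv_mul (f Sopt), ← one_div (2 : ℝ)] at happrox
    obtain ⟨hint, hle⟩ := integral_regret_le hX hM hm (measurable_run_greedyMax c B tie)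
      hfeas.action_mem hr0 (by norm_num) hε (by positivity) hSopt happrox i T
    refine ⟨hint, hle.trans ?_⟩
    have hP : Real.exp (-(2 * (m * r) * (l ^ 3 / z) ^ 2)) ≤ 1 / τ ^ 6 := by
      have h1 : Real.log T ≤ m * r * (l ^ 3 / z) ^ 2 := by
        calc Real.log T = z ^ 2 * (l ^ 3 / z) ^ 2 := by
              rw [div_pow, ← pow_mul, hl6]; field_simp
          _ ≤ m * r * (l ^ 3 / z) ^ 2 := by gcongr
      have h2 : τ ^ 6 = Real.exp (2 * Real.log T) := by
        rw [two_mul, Real.exp_add, Real.exp_log (by linarith), ← hτ3]; ring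
      rw [h2, one_div, ← Real.exp_neg]
      exact Real.exp_le_exp.2 (by linarith)
    have hbal := exploration_balance
      (N := ((Fintype.card (Fin n) * ⌊K⌋₊ + 1 : ℕ) : ℝ)) ha1 hb1 hk1 hν1 hτ1 hl0 hbd hd2
      hτψ (by rw [hl6]; linarith) hz (by rw [hν3, hk3]; exact hN) (by rw [ha3]; exact hr2)
      (Nat.cast_nonneg r) (Real.exp_pos _).le hP
    rw [pow_one, Real.rpow_neg (by positivity), rpow_two_thirds (by positivity : 0 ≤ q),
      rpow_two_thirds (by positivity : (0 : ℝ) ≤ T), ← ha, ← hb, ← hν, ← hτ]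
    rw [hτ3, hb3, hk3, hl6] at hbal
    exact hbal
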